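/- Setting. Let $(N',\rho)$ be a compact smooth Riemannian surface without boundary, with geodesic distance and geodesic balls $B(x,r)$, and let $i:N'\to\mathbb{R}^k$ be a smooth isometric (Nash) embedding, fixed together with $N'$, with second fundamental form $A'$ (the normal part of the second derivative of $i$). Let $M$ be a Riemannian surface with boundary with a global conformal coordinate $z=x+iy$, in which its interior is a bounded open set $\Omega\subset\mathbb{C}$ and its metric is $\sigma(z)|dz|^2$ with $\sigma$ continuous and bounded above and below by positive constants on $\Omega$; so $dV_M=\sigma\,dx\,dy$. For $v=i\circ u$ with $u:M\to N'$, put $|\nabla v|^2=\sigma^{-1}(|\partial_x v|^2+|\partial_y v|^2)$, $\nabla v\cdot\nabla\psi=\sigma^{-1}(\partial_xv\cdot\partial_x\psi+\partial_yv\cdot\partial_y\psi)$ and $A'(v)(\nabla v,\nabla v)=\sigma^{-1}\big(A'(\partial_xu,\partial_xu)+A'(\partial_yu,\partial_yu)\big)$. Given $p\ge 2$ and $\epsilon>0$, such a $v$ is a solution of the $\epsilon$-perturbed $p$-harmonic system if $v\in W^{1,p}(M,\mathbb{R}^k)$ and, with $\lambda^\epsilon=(\epsilon^2+|\nabla v|^2)^{\frac{p-2}{2}}$,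 $$-\int_M\lambda^\epsilon\,\nabla v\cdot\nabla\psi\,dV_M=\int_M\lambda^\epsilon A'(v)(\nabla v,\nabla v)\cdot\psi\,dV_M\qquad\text{for all }\psi\in C_0^\infty(\operatorname{int}M,\mathbb{R}^k).$$ Theorem (uniqueness). Let $N'$, $i$ and $p\ge2$ be as above. There is a radius $r_0>0$, depending only on $p$ and on $N'$ with its embedding $i$ (and not on $M$, $\epsilon$, the centre of the ball or the solutions), such that the following holds for every $M$ as above, every $\epsilon>0$ and every $x\in N'$. If $v_1^\epsilon$ and $v_2^\epsilon$ are two solutions of the $\epsilon$-perturbed $p$-harmonic system on $M$ with $v_1^\epsilon(M)\subset i(B(x,r_0))$ and $v_2^\epsilon(M)\subset i(B(x,r_0))$ (almost everywhere), and $v_1^\epsilon=v_2^\epsilon$ on $\partial M$ in the Sobolev sense, i.e. $v_1^\epsilon-v_2^\epsilon\in W^{1,p}_0(M,\mathbb{R}^k)$ (the $W^{1,p}$-closure of $C_0^\infty(\operatorname{int}M,\mathbb{R}^k)$), then $v_1^\epsilon=v_2^\epsilon$ almost everywhere in $M$. -/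

import Mathlib

open Set Filter Topology MeasureTheory Manifold Bundle
open scoped ContDiff ENNReal

noncomputable section

namespace PHarm

/-! ### Sobolev spaces on an open set `Ω ⊆ ℂ`

`Ω` is the interior of the source surface in its global conformal coordinate `z = x + i y`.
Since the conformal factor is bounded above and below, the Sobolev spaces of the surface are those
of `Ω` with Lebesgue measure (with equivalent norms). -/

section Sobolev

variable {F : Type*} [NormedAddCommGroup F] [NormedSpace ℝ F]

/-- `φ ∈ C_c^∞(Ω, F)`. -/
def IsTestFunction (Ω : Set ℂ) (φ : ℂ → F) : Prop :=
  ContDiff ℝ ∞ φ ∧ HasCompactSupport φ ∧ tsupport φ ⊆ Ω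

/-- `G` is the weak (distributional) differential of `v` on the open set `Ω`:
`∫ (∂_h φ) v = - ∫ φ G(h)` for all real test functions `φ` and all directions `h`. -/
def HasWeakDifferential (Ω : Set ℂ) (v : ℂ → F) (G : ℂ → ℂ →L[ℝ] F) : Prop :=
  LocallyIntegrableOn v Ω ∧ LocallyIntegrableOn G Ω ∧
    ∀ φ : ℂ → ℝ, IsTestFunction Ω φ → ∀ h : ℂ,
      ∫ z in Ω, (fderiv ℝ φ z h) • v z = - ∫ z in Ω, φ z • G z h

/-- `v ∈ W^{1,p}(Ω, F)` with weak differential `G`. -/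
def IsSobolev (Ω : Set ℂ) (p : ℝ) (v : ℂ → F) (G : ℂ → ℂ →L[ℝ] F) : Prop :=
  HasWeakDifferential Ω v G ∧
    MemLp v (ENNReal.ofReal p) (volume.restrict Ω) ∧
    MemLp G (ENNReal.ofReal p) (volume.restrict Ω)

/-- `η ∈ W^{1,p}_0(Ω, F)`: `η` is the limit of functions of `C_c^∞(Ω, F)` in the norm of
`W^{1,p}`. -/
def IsSobolevZero (Ω : Set ℂ) (p : ℝ) (η : ℂ → F) : Prop :=
  ∃ G : ℂ → ℂ →L[ℝ] F, IsSobolev Ω p η G ∧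
    ∃ φ : ℕ → ℂ → F, (∀ n, IsTestFunction Ω (φ n)) ∧
      Tendsto (fun n => eLpNorm (fun z => φ n z - η z) (ENNReal.ofReal p) (volume.restrict Ω))
        atTop (𝓝 0) ∧
      Tendsto (fun n => eLpNorm (fun z => fderiv ℝ (φ n) z - G z) (ENNReal.ofReal p)
        (volume.restrict Ω)) atTop (𝓝 0)

end Sobolev

/-! ### The target surface and its isometric embedding -/

section Target

variable {N' : Type*} [MetricSpace N'] [ChartedSpace (EuclideanSpace ℝ (Fin 2)) N'] {k : ℕ}

/-- The differential `di_x : T_x N' → ℝ^k`. -/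
def differential (i : N' → EuclideanSpace ℝ (Fin k)) (x : N') :
    TangentSpace (𝓡 2) x →L[ℝ] EuclideanSpace ℝ (Fin k) :=
  mfderiv (𝓡 2) 𝓘(ℝ, EuclideanSpace ℝ (Fin k)) i x

/-- The second fundamental form `A'(V, W)` of `i(N')` at `i x`, for `V, W ∈ T_x N'`: the normal
part of the second derivative of `i`, i.e. `∂²i/∂u^m∂u^n - Γ^l_{mn} ∂i/∂u^l` in coordinates.
It is computed in the preferred chart at `x`, through which Mathlib identifies `T_x N'` with
`ℝ²`. -/
def secondFundamentalForm (i : N' → EuclideanSpace ℝ (Fin k)) (x : N')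
    (V W : TangentSpace (𝓡 2) x) : EuclideanSpace ℝ (Fin k) :=
  (LinearMap.range (differential i x).toLinearMap)ᗮ.starProjection
    (fderiv ℝ (fderiv ℝ (i ∘ (extChartAt (𝓡 2) x).symm)) (extChartAt (𝓡 2) x x) V W)

variable [RiemannianBundle (fun x : N' => TangentSpace (𝓡 2) x)]

/-- `i : N' → ℝ^k` is a smooth isometric embedding of the Riemannian surface `N'`, in the sense
of Riemannian geometry. -/
structure IsIsometricEmbedding (i : N' → EuclideanSpace ℝ (Fin k)) : Prop where
  smooth : ContMDiff (𝓡 2) 𝓘(ℝ, EuclideanSpace ℝ (Fin k)) ∞ i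
  isEmbedding : IsEmbedding i
  isometric : ∀ (x : N') (V W : TangentSpace (𝓡 2) x),
    inner ℝ (differential i x V) (differential i x W) = inner ℝ V W

/-- The vector `U ∈ T_x N'` with `di_x(U) = X`, for `X ∈ ℝ^k` tangent to `i(N')` at `i x`. It is
written as `(di_x)^* X`, which is the same because `di_x` is isometric; for general `X`, `di_x(U)`
is the tangential part of `X`. -/
def tangentLift (i : N' → EuclideanSpace ℝ (Fin k)) (x : N') (X : EuclideanSpace ℝ (Fin k)) :
    TangentSpace (𝓡 2) x :=
  haveI : FiniteDimensional ℝ (TangentSpace (𝓡 2) x) :=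
    inferInstanceAs (FiniteDimensional ℝ (EuclideanSpace ℝ (Fin 2)))
  LinearMap.adjoint (differential i x).toLinearMap X

/-! ### The perturbed system

For `v : Ω → ℝ^k` with weak differential `G`, the partial derivatives at `z` are
`∂v/∂x = G z 1` and `∂v/∂y = G z I`. -/

/-- `|∇v|² = σ⁻¹ (|∂v/∂x|² + |∂v/∂y|²)`, with `D = dv` at the point and `s` the value of `σ`. -/
def gradSq (s : ℝ) (D : ℂ →L[ℝ] EuclideanSpace ℝ (Fin k)) : ℝ :=
  s⁻¹ * (‖D 1‖ ^ 2 + ‖D Complex.I‖ ^ 2)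

/-- `∇v · ∇ψ = σ⁻¹ (∂v/∂x · ∂ψ/∂x + ∂v/∂y · ∂ψ/∂y)`. -/
def gradInner (s : ℝ) (D D' : ℂ →L[ℝ] EuclideanSpace ℝ (Fin k)) : ℝ :=
  s⁻¹ * (inner ℝ (D 1) (D' 1) + inner ℝ (D Complex.I) (D' Complex.I))

/-- `λ^ε = (ε² + |∇v|²)^((p-2)/2)`. -/
def weight (p ε s : ℝ) (D : ℂ →L[ℝ] EuclideanSpace ℝ (Fin k)) : ℝ :=
  (ε ^ 2 + gradSq s D) ^ ((p - 2) / 2)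

/-- `A'(v)(∇v, ∇v) = σ⁻¹ (A'(∂u/∂x, ∂u/∂x) + A'(∂u/∂y, ∂u/∂y))` at a point where `u = x`,
`v = i ∘ u` and `dv = D`. -/
def curvatureTerm (i : N' → EuclideanSpace ℝ (Fin k)) (s : ℝ) (x : N')
    (D : ℂ →L[ℝ] EuclideanSpace ℝ (Fin k)) : EuclideanSpace ℝ (Fin k) :=
  s⁻¹ • (secondFundamentalForm i x (tangentLift i x (D 1)) (tangentLift i x (D 1)) +
    secondFundamentalForm i x (tangentLift i x (D Complex.I)) (tangentLift i x (D Complex.I)))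

/-- `v = i ∘ u`, with `u : Ω → N'`, is in `W^{1,p}(Ω, ℝ^k)` and is a weak solution of the
`ε`-perturbed `p`-harmonic system
`- ∫ λ^ε ∇v · ∇ψ dV = ∫ λ^ε A'(v)(∇v, ∇v) · ψ dV` for all `ψ ∈ C_c^∞(Ω, ℝ^k)`,
where `Ω` carries the metric `σ |dz|²`, so that `dV = σ dx dy`. -/
def IsPerturbedSolution (i : N' → EuclideanSpace ℝ (Fin k)) (Ω : Set ℂ) (σ : ℂ → ℝ) (p ε : ℝ)
    (u : ℂ → N') : Prop :=
  ∃ G : ℂ → ℂ →L[ℝ] EuclideanSpace ℝ (Fin k),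
    IsSobolev Ω p (fun z => i (u z)) G ∧
    ∀ ψ : ℂ → EuclideanSpace ℝ (Fin k), IsTestFunction Ω ψ →
      - ∫ z in Ω, weight p ε (σ z) (G z) * gradInner (σ z) (G z) (fderiv ℝ ψ z) * σ z =
        ∫ z in Ω, weight p ε (σ z) (G z) *
          inner ℝ (curvatureTerm i (σ z) (u z) (G z)) (ψ z) * σ z

end Target

end PHarm

end

/-!
# Uniqueness of perturbed `p`-harmonic maps into small balls

Let `v₁ = i ∘ u₁`, `v₂ = i ∘ u₂` be two solutions with values near the point `q = i x`, put
`η = v₁ - v₂ ∈ W^{1,p}_0`, and let `λ₁`, `λ₂` be their weights. In the conformal coordinate the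
factor `σ` occurs only inside the weights. Testing the two equations with `η` and subtracting gives

  `∫ ⟨λ₁ ∇v₁ - λ₂ ∇v₂, ∇η⟩ = - ∫ λ₁ ⟨A'(v₁)(∇v₁, ∇v₁), η⟩ + ∫ λ₂ ⟨A'(v₂)(∇v₂, ∇v₂), η⟩`.

*Left hand side.* The weight is an increasing function of the energy density, so the flux is
monotone and the left hand side is at least `½ ∫ (λ₁ + λ₂) |∇η|²` (`half_mul_hsSq_sub_le`,
`weight_sub_mul_nonneg`).

*Right hand side.* The second fundamental form is normal to the surface, and a chord of the compact
surface `i(N')` is tangential up to an error quadratic in its length (`exists_inner_normal_le`, from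
Taylor's formula near the diagonal and compactness away from it). Hence the right hand side is at
most `C ∑ⱼ ∫ λⱼ |∇vⱼ|² |η|²`.

*Absorption.* Testing the equation of `vⱼ` with `|η|² (vⱼ - q)`, where `|vⱼ - q| ≤ δ`, yields the
Caccioppoli inequality `∫ λⱼ |∇vⱼ|² |η|² ≤ 8 δ² ∫ λⱼ |∇η|²` as soon as `C δ ≤ 1/4` (`caccioppoli`).
If moreover `C δ² ≤ 1/32`, the estimates together force `∇η = 0` (`ae_eq_zero_of_energy`), and
`η = 0` by the Poincaré inequality (`IsSobolevZero.ae_eq_zero`). The constant `C` depends on the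
embedding only, and by uniform continuity of `i` there is a radius `r₀`, the same for all centres,
such that points of a ball of radius `r₀` are mapped to points at distance at most `δ` from `q`.

Two points need an argument. Neither `η` nor `|η|² (vⱼ - q)` is a smooth test field; they are
admissible because they are limits in `W^{1,p}` of uniformly bounded test functions, obtained by
truncation and mollification (`weakEq_of_isSobolevZero`). The uniform bound matters because the
curvature term is only in `L^1`. And the second fundamental form is defined pointwise, in the
preferred chart of each point; its continuity, which gives both its measurability along a map and
its bound on the compact surface, is seen by rewriting it in a fixed chart with the
Moore-Penrose inverse of the differential (`secondForm_eq`, `continuous_secondForm`).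
-/

noncomputable section

namespace PHarm

/-! ### Linear algebra of injective maps -/

section PseudoInverse

variable {Q E : Type*} [NormedAddCommGroup Q] [InnerProductSpace ℝ Q] [FiniteDimensional ℝ Q]
  [NormedAddCommGroup E] [InnerProductSpace ℝ E] [FiniteDimensional ℝ E]

/-- The Moore-Penrose inverse `(B† B)⁻¹ B†` of an injective linear map `B`. If `B` is not injective
the inverse takes its default value `0`. -/
def pinv (B : Q →L[ℝ] E) : E →L[ℝ] Q :=
  (ContinuousLinearMap.inverse ((ContinuousLinearMap.adjoint B).comp B)).comp
    (ContinuousLinearMap.adjoint B)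

lemma isInvertible_adjoint_comp_self {B : Q →L[ℝ] E} (hB : Function.Injective B) :
    ((ContinuousLinearMap.adjoint B).comp B).IsInvertible := by
  have hinj : Function.Injective ((ContinuousLinearMap.adjoint B).comp B) := by
    rw [injective_iff_map_eq_zero]
    intro v hv
    have h : inner ℝ (ContinuousLinearMap.adjoint B (B v)) v = 0 := by
      rw [show ContinuousLinearMap.adjoint B (B v) = 0 from hv, inner_zero_left]
    rw [ContinuousLinearMap.adjoint_inner_left, inner_self_eq_zero] at h
    exact hB (by simpa using h)
  refine ⟨(LinearEquiv.ofInjectiveEndo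
    ((ContinuousLinearMap.adjoint B).comp B).toLinearMap hinj).toContinuousLinearEquiv, ?_⟩
  ext v
  rfl

lemma pinv_apply_apply {B : Q →L[ℝ] E} (hB : Function.Injective B) (v : Q) :
    pinv B (B v) = v := by
  obtain ⟨e, he⟩ := isInvertible_adjoint_comp_self hB
  have : (ContinuousLinearMap.adjoint B) (B v) = e v := by
    have := congrArg (fun T : Q →L[ℝ] Q => T v) he
    simpa using this.symm
  simp [pinv, ← he, this]

lemma continuousAt_pinv {B : Q →L[ℝ] E} (hB : Function.Injective B) : ContinuousAt pinv B := by
  obtain ⟨e, he⟩ := isInvertible_adjoint_comp_self hB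
  have hadj : Continuous fun B : Q →L[ℝ] E => ContinuousLinearMap.adjoint B :=
    ContinuousLinearMap.adjoint.continuous
  have h1 : ContinuousAt (fun B : Q →L[ℝ] E => (ContinuousLinearMap.adjoint B).comp B) B :=
    (hadj.clm_comp continuous_id).continuousAt
  have h2 : ContinuousAt (ContinuousLinearMap.inverse : (Q →L[ℝ] Q) → (Q →L[ℝ] Q))
      ((ContinuousLinearMap.adjoint B).comp B) := by
    rw [← he]
    exact (contDiffAt_map_inverse (n := 0) e).continuousAt
  exact (ContinuousAt.comp (f := fun B : Q →L[ℝ] E => (ContinuousLinearMap.adjoint B).comp B)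
    h2 h1).clm_comp hadj.continuousAt

/-- A vector and its projection to the range of `B` have the same image under `pinv B`. -/
lemma pinv_eq_of_sub_mem {B : Q →L[ℝ] E} {X Y : E}
    (h : X - Y ∈ (LinearMap.range B.toLinearMap)ᗮ) : pinv B X = pinv B Y := by
  have : ContinuousLinearMap.adjoint B (X - Y) = 0 := by
    refine ext_inner_right ℝ fun w => ?_
    rw [ContinuousLinearMap.adjoint_inner_left, inner_zero_left, real_inner_comm]
    exact h (B w) ⟨w, rfl⟩
  have h2 : ContinuousLinearMap.adjoint B X = ContinuousLinearMap.adjoint B Y := by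
    rwa [map_sub, sub_eq_zero] at this
  simp [pinv, h2]

lemma starProjection_range_orthogonal {B : Q →L[ℝ] E} (hB : Function.Injective B) (X : E) :
    (LinearMap.range B.toLinearMap)ᗮ.starProjection X = X - B (pinv B X) := by
  rw [Submodule.starProjection_orthogonal']
  change X - (LinearMap.range B.toLinearMap).starProjection X = X - B (pinv B X)
  congr 1
  obtain ⟨v, hv⟩ := Submodule.starProjection_apply_mem (LinearMap.range B.toLinearMap) X
  have h : pinv B X = pinv B (B v) := pinv_eq_of_sub_mem (by
    rw [show B v = _ from hv]; exact Submodule.sub_starProjection_mem_orthogonal X)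
  rw [h, pinv_apply_apply hB]
  exact hv.symm

end PseudoInverse

/-- Second order Taylor estimate for an immersion: the displacement `f b - f a` is tangent at `a`
up to an error quadratic in the displacement itself. -/
lemma eventually_taylor_le_sq {Q E : Type*} [NormedAddCommGroup Q] [NormedSpace ℝ Q]
    [FiniteDimensional ℝ Q] [NormedAddCommGroup E] [NormedSpace ℝ E] {f : Q → E} {a₀ : Q}
    (hf : ContDiffAt ℝ 2 f a₀) (hinj : Function.Injective (fderiv ℝ f a₀)) :
    ∃ C : ℝ, ∀ᶠ ab in 𝓝 (a₀, a₀),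
      ‖f ab.2 - f ab.1 - fderiv ℝ f ab.1 (ab.2 - ab.1)‖ ≤ C * ‖f ab.2 - f ab.1‖ ^ 2 := by
  obtain ⟨K, hK0, hK⟩ := (fderiv ℝ f a₀).toLinearMap.exists_antilipschitzWith
    (LinearMap.ker_eq_bot.2 hinj)
  have hKpos : (0 : ℝ) < K := by exact_mod_cast hK0
  have hanti : ∀ v, ‖v‖ ≤ K * ‖fderiv ℝ f a₀ v‖ := fun v => by
    simpa using hK.le_mul_dist v 0
  have hstrict := hf.hasStrictFDerivAt (by norm_num)
  have hlow : ∀ᶠ ab : Q × Q in 𝓝 (a₀, a₀), ‖ab.2 - ab.1‖ ≤ 2 * K * ‖f ab.2 - f ab.1‖ := by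
    have h1 := (hasStrictFDerivAt_iff_isLittleO.1 hstrict).def (c := (2 * K : ℝ)⁻¹) (by positivity)
    filter_upwards [h1] with ab h
    have h2 := hanti (ab.1 - ab.2)
    have h3 : ‖fderiv ℝ f a₀ (ab.1 - ab.2)‖ ≤
        ‖f ab.1 - f ab.2‖ + ‖f ab.1 - f ab.2 - fderiv ℝ f a₀ (ab.1 - ab.2)‖ := by
      have := norm_sub_le (f ab.1 - f ab.2) (f ab.1 - f ab.2 - fderiv ℝ f a₀ (ab.1 - ab.2))
      simpa using this
    rw [norm_sub_rev ab.2, norm_sub_rev (f ab.2)]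
    have h4 : K * ((2 * K : ℝ)⁻¹ * ‖ab.1 - ab.2‖) = ‖ab.1 - ab.2‖ / 2 := by field_simp
    have h5 := mul_le_mul_of_nonneg_left (h3.trans (add_le_add_right h _)) hKpos.le
    rw [mul_add, h4] at h5
    linarith
  obtain ⟨L, s, hs, hL⟩ := (hf.fderiv_right (m := 1) (by norm_num)).exists_lipschitzOnWith
  have hd : ∀ᶠ y in 𝓝 a₀, DifferentiableAt ℝ f y :=
    (hf.eventually (by simp)).mono fun y hy => hy.differentiableAt (by norm_num)
  obtain ⟨r, hr, hball⟩ := Metric.eventually_nhds_iff_ball.1 (hd.and hs)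
  have hb : ∀ᶠ ab : Q × Q in 𝓝 (a₀, a₀), ab.1 ∈ Metric.ball a₀ r ∧ ab.2 ∈ Metric.ball a₀ r := by
    rw [nhds_prod_eq]
    exact (eventually_of_mem (Metric.ball_mem_nhds a₀ hr) fun _ h => h).prod_mk
      (eventually_of_mem (Metric.ball_mem_nhds a₀ hr) fun _ h => h)
  refine ⟨L * (2 * K) ^ 2, ?_⟩
  filter_upwards [hlow, hb] with ⟨a, b⟩ h1 h2
  simp only at h1 h2 ⊢
  have hseg : segment ℝ a b ⊆ Metric.ball a₀ r := (convex_ball a₀ r).segment_subset h2.1 h2.2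
  have hT : ‖f b - f a - fderiv ℝ f a (b - a)‖ ≤ (L * ‖b - a‖) * ‖b - a‖ := by
    refine Convex.norm_image_sub_le_of_norm_hasFDerivWithin_le' (s := segment ℝ a b)
      (f' := fderiv ℝ f) (fun y hy => (hball y (hseg hy)).1.hasFDerivAt.hasFDerivWithinAt)
      (fun y hy => ?_) (convex_segment a b) (left_mem_segment ℝ a b) (right_mem_segment ℝ a b)
    refine (hL.norm_sub_le (hball y (hseg hy)).2 (hball a h2.1).2).trans ?_
    gcongr
    exact norm_sub_le_of_mem_segment hy
  calc _ ≤ L * ‖b - a‖ ^ 2 := by rw [pow_two, ← mul_assoc]; exact hT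
    _ ≤ L * (2 * K * ‖f b - f a‖) ^ 2 := by gcongr
    _ = _ := by ring

/-! ### The second fundamental form in a fixed chart -/

section Charts

variable {N' : Type*} [MetricSpace N'] [ChartedSpace (EuclideanSpace ℝ (Fin 2)) N']
  {k : ℕ} {i : N' → EuclideanSpace ℝ (Fin k)}

/-- The map `i` written in the preferred chart at `x₀`. -/
def chartRep (i : N' → EuclideanSpace ℝ (Fin k)) (x₀ : N') :
    EuclideanSpace ℝ (Fin 2) → EuclideanSpace ℝ (Fin k) :=
  i ∘ (extChartAt (𝓡 2) x₀).symm

lemma contDiffAt_chartRep [IsManifold (𝓡 2) ∞ N']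
    (hi : ContMDiff (𝓡 2) 𝓘(ℝ, EuclideanSpace ℝ (Fin k)) ∞ i) {x₀ x : N'}
    (hx : x ∈ (extChartAt (𝓡 2) x₀).source) :
    ContDiffAt ℝ ∞ (chartRep i x₀) (extChartAt (𝓡 2) x₀ x) := by
  rw [← contMDiffAt_iff_contDiffAt]
  have h := (contMDiffOn_extChartAt_symm (I := 𝓡 2) (n := ∞) x₀).contMDiffAt
    ((isOpen_extChartAt_target (I := 𝓡 2) x₀).mem_nhds ((extChartAt (𝓡 2) x₀).map_source hx))
  exact (hi.contMDiffAt).comp _ h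

lemma differential_eq_fderiv (hi : ContMDiff (𝓡 2) 𝓘(ℝ, EuclideanSpace ℝ (Fin k)) ∞ i) (x : N') :
    differential i x = fderiv ℝ (chartRep i x) (extChartAt (𝓡 2) x x) := by
  have h : MDifferentiableAt (𝓡 2) 𝓘(ℝ, EuclideanSpace ℝ (Fin k)) i x :=
    hi.mdifferentiableAt (by simp)
  unfold differential
  rw [h.mfderiv]
  simp only [modelWithCornersSelf_coe, range_id, fderivWithin_univ]
  rfl

/-- The transition map from the preferred chart at `x` to the one at `x₀`. -/
def transition (x₀ x : N') : EuclideanSpace ℝ (Fin 2) → EuclideanSpace ℝ (Fin 2) :=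
  extChartAt (𝓡 2) x₀ ∘ (extChartAt (𝓡 2) x).symm

lemma transition_self (x₀ x : N') :
    transition x₀ x (extChartAt (𝓡 2) x x) = extChartAt (𝓡 2) x₀ x := by
  simp [transition]

lemma contDiffAt_transition [IsManifold (𝓡 2) ∞ N'] {x₀ x : N'}
    (hx : x ∈ (extChartAt (𝓡 2) x₀).source) :
    ContDiffAt ℝ ∞ (transition x₀ x) (extChartAt (𝓡 2) x x) := by
  rw [← contMDiffAt_iff_contDiffAt]
  have h := (contMDiffOn_extChartAt_symm (I := 𝓡 2) (n := ∞) x).contMDiffAt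
    ((isOpen_extChartAt_target (I := 𝓡 2) x).mem_nhds (mem_extChartAt_target x))
  refine ContMDiffAt.comp (I' := 𝓡 2) _ ?_ h
  rw [extChartAt_to_inv]
  exact contMDiffAt_extChartAt' (by rwa [extChartAt_source] at hx)

lemma chartRep_eventuallyEq {x₀ x : N'} (hx : x ∈ (extChartAt (𝓡 2) x₀).source) :
    chartRep i x =ᶠ[𝓝 (extChartAt (𝓡 2) x x)] chartRep i x₀ ∘ transition x₀ x := by
  have h := (continuousAt_extChartAt_symm (I := 𝓡 2) x).preimage_mem_nhds
    (by rw [extChartAt_to_inv]; exact (isOpen_extChartAt_source (I := 𝓡 2) x₀).mem_nhds hx)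
  filter_upwards [h] with y hy
  exact (congrArg i ((extChartAt (𝓡 2) x₀).left_inv hy)).symm

/-- The derivative of `i` in the chart at `x₀`, at the point representing `x`. -/
def chartDeriv (i : N' → EuclideanSpace ℝ (Fin k)) (x₀ x : N') :
    EuclideanSpace ℝ (Fin 2) →L[ℝ] EuclideanSpace ℝ (Fin k) :=
  fderiv ℝ (chartRep i x₀) (extChartAt (𝓡 2) x₀ x)

lemma differential_eq_comp [IsManifold (𝓡 2) ∞ N']
    (hi : ContMDiff (𝓡 2) 𝓘(ℝ, EuclideanSpace ℝ (Fin k)) ∞ i) {x₀ x : N'}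
    (hx : x ∈ (extChartAt (𝓡 2) x₀).source) :
    differential i x = (chartDeriv i x₀ x).comp
      (fderiv ℝ (transition x₀ x) (extChartAt (𝓡 2) x x)) := by
  rw [differential_eq_fderiv hi, (chartRep_eventuallyEq hx).fderiv_eq, fderiv_comp,
    transition_self]
  · rfl
  · rw [transition_self]; exact (contDiffAt_chartRep hi hx).differentiableAt (by simp)
  · exact (contDiffAt_transition hx).differentiableAt (by simp)

/-- Change of coordinates for the second derivative. The additional term contains the second
derivative of the transition map and is tangential. -/
lemma fderiv_fderiv_chartRep [IsManifold (𝓡 2) ∞ N']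
    (hi : ContMDiff (𝓡 2) 𝓘(ℝ, EuclideanSpace ℝ (Fin k)) ∞ i) {x₀ x : N'}
    (hx : x ∈ (extChartAt (𝓡 2) x₀).source) (V : EuclideanSpace ℝ (Fin 2)) :
    ∃ Z, fderiv ℝ (fderiv ℝ (chartRep i x)) (extChartAt (𝓡 2) x x) V V =
      fderiv ℝ (fderiv ℝ (chartRep i x₀)) (extChartAt (𝓡 2) x₀ x)
        (fderiv ℝ (transition x₀ x) (extChartAt (𝓡 2) x x) V)
        (fderiv ℝ (transition x₀ x) (extChartAt (𝓡 2) x x) V) + chartDeriv i x₀ x Z := by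
  set a := extChartAt (𝓡 2) x x
  have hτ := contDiffAt_transition hx
  have hτa : transition x₀ x a = extChartAt (𝓡 2) x₀ x := transition_self x₀ x
  have hf := contDiffAt_chartRep hi hx
  have hf' : ContDiffAt ℝ ∞ (chartRep i x₀) (transition x₀ x a) := by rwa [hτa]
  have h1 : fderiv ℝ (chartRep i x) =ᶠ[𝓝 a] fun y =>
      (fderiv ℝ (chartRep i x₀) (transition x₀ x y)).comp (fderiv ℝ (transition x₀ x) y) := by
    have e1 : ∀ᶠ y in 𝓝 a, DifferentiableAt ℝ (transition x₀ x) y :=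
      ((hτ.of_le (m := 1) (mod_cast le_top)).eventually (by simp)).mono
        fun y hy => hy.differentiableAt (by simp)
    have e2 : ∀ᶠ y in 𝓝 a, DifferentiableAt ℝ (chartRep i x₀) (transition x₀ x y) :=
      hτ.continuousAt.eventually (((hf'.of_le (m := 1) (mod_cast le_top)).eventually (by simp)).mono
        fun y hy => hy.differentiableAt (by simp))
    filter_upwards [(chartRep_eventuallyEq (i := i) hx).fderiv (𝕜 := ℝ), e1, e2] with y h h1 h2
    rw [h, fderiv_comp _ h2 h1]
  have d1 : HasFDerivAt (fun y => fderiv ℝ (chartRep i x₀) (transition x₀ x y))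
      ((fderiv ℝ (fderiv ℝ (chartRep i x₀)) (transition x₀ x a)).comp
        (fderiv ℝ (transition x₀ x) a)) a :=
    ((hf'.fderiv_right (m := ∞) le_rfl).differentiableAt (by simp)).hasFDerivAt.comp a
      (hτ.differentiableAt (by simp)).hasFDerivAt
  have d2 : HasFDerivAt (fderiv ℝ (transition x₀ x))
      (fderiv ℝ (fderiv ℝ (transition x₀ x)) a) a :=
    ((hτ.fderiv_right (m := ∞) le_rfl).differentiableAt (by simp)).hasFDerivAt
  refine ⟨fderiv ℝ (fderiv ℝ (transition x₀ x)) a V V, ?_⟩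
  rw [h1.fderiv_eq, (d1.clm_comp d2).fderiv, hτa]
  simp [chartDeriv, add_comm]

end Charts

section Isometric

variable {N' : Type*} [MetricSpace N'] [ChartedSpace (EuclideanSpace ℝ (Fin 2)) N']
  [RiemannianBundle (fun x : N' => TangentSpace (𝓡 2) x)]
  {k : ℕ} {i : N' → EuclideanSpace ℝ (Fin k)}

lemma differential_injective (hi : IsIsometricEmbedding i) (x : N') :
    Function.Injective (differential i x) := by
  rw [injective_iff_map_eq_zero]
  intro V hV
  have h := hi.isometric x V V
  rw [hV, inner_zero_left] at h
  exact inner_self_eq_zero.1 h.symm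

/-- `di_x ∘ di_x^*` is the orthogonal projection to the tangent plane: the error is normal. -/
lemma sub_differential_tangentLift_mem (hi : IsIsometricEmbedding i) (x : N')
    (X : EuclideanSpace ℝ (Fin k)) :
    X - differential i x (tangentLift i x X) ∈
      (LinearMap.range (differential i x).toLinearMap)ᗮ := by
  rintro _ ⟨W, rfl⟩
  have : FiniteDimensional ℝ (TangentSpace (𝓡 2) x) :=
    inferInstanceAs (FiniteDimensional ℝ (EuclideanSpace ℝ (Fin 2)))
  rw [inner_sub_right]
  have h := hi.isometric x W (tangentLift i x X)
  have h2 : inner ℝ W (tangentLift i x X) = inner ℝ (differential i x W) X :=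
    LinearMap.adjoint_inner_right _ _ _
  rw [sub_eq_zero]
  exact h2.symm.trans h.symm

lemma range_differential [IsManifold (𝓡 2) ∞ N'] (hi : IsIsometricEmbedding i) {x₀ x : N'}
    (hx : x ∈ (extChartAt (𝓡 2) x₀).source) :
    Function.Injective (chartDeriv i x₀ x) ∧
    LinearMap.range (differential i x).toLinearMap =
      LinearMap.range (chartDeriv i x₀ x).toLinearMap := by
  have hcomp := differential_eq_comp hi.smooth hx
  set T : EuclideanSpace ℝ (Fin 2) →L[ℝ] EuclideanSpace ℝ (Fin 2) :=
    fderiv ℝ (transition x₀ x) (extChartAt (𝓡 2) x x) with hT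
  have happ : ∀ V : EuclideanSpace ℝ (Fin 2), differential i x V = chartDeriv i x₀ x (T V) :=
    fun V => congrArg (fun S : EuclideanSpace ℝ (Fin 2) →L[ℝ] EuclideanSpace ℝ (Fin k) => S V) hcomp
  have hTinj : Function.Injective T.toLinearMap := by
    intro V W hVW
    have h : T V = T W := hVW
    exact differential_injective hi x ((happ V).trans ((congrArg _ h).trans (happ W).symm))
  have hTsurj : Function.Surjective T := LinearMap.surjective_of_injective hTinj
  constructor
  · intro V W hVW
    obtain ⟨V, rfl⟩ := hTsurj V
    obtain ⟨W, rfl⟩ := hTsurj W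
    exact congrArg T (differential_injective hi x ((happ V).trans (hVW.trans (happ W).symm)))
  · ext Y
    constructor
    · rintro ⟨V, rfl⟩
      exact ⟨T V, (happ V).symm⟩
    · rintro ⟨V, rfl⟩
      obtain ⟨V, rfl⟩ := hTsurj V
      exact ⟨V, happ V⟩

/-- The quadratic map `X ↦ A'(X^⊤, X^⊤)`, with `X^⊤` the tangential part of `X` at `i x`. -/
def secondForm (i : N' → EuclideanSpace ℝ (Fin k)) (x : N') (X : EuclideanSpace ℝ (Fin k)) :
    EuclideanSpace ℝ (Fin k) :=
  secondFundamentalForm i x (tangentLift i x X) (tangentLift i x X)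

lemma secondForm_mem (x : N') (X : EuclideanSpace ℝ (Fin k)) :
    secondForm i x X ∈ (LinearMap.range (differential i x).toLinearMap)ᗮ :=
  Submodule.starProjection_apply_mem _ _

lemma secondForm_smul (x : N') (t : ℝ) (X : EuclideanSpace ℝ (Fin k)) :
    secondForm i x (t • X) = t ^ 2 • secondForm i x X := by
  have : FiniteDimensional ℝ (TangentSpace (𝓡 2) x) :=
    inferInstanceAs (FiniteDimensional ℝ (EuclideanSpace ℝ (Fin 2)))
  have h : tangentLift i x (t • X) = t • tangentLift i x X := map_smul _ t X
  have h2 : ∀ (B : EuclideanSpace ℝ (Fin 2) →L[ℝ] EuclideanSpace ℝ (Fin 2) →L[ℝ]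
      EuclideanSpace ℝ (Fin k)) (V : EuclideanSpace ℝ (Fin 2)),
      B (t • V) (t • V) = t ^ 2 • B V V := fun B V => by
    rw [map_smul, map_smul, smul_apply, smul_smul, pow_two]
  unfold secondForm secondFundamentalForm
  rw [h, ← map_smul]
  exact congrArg _ (h2 _ _)

/-- The second fundamental form in the chart at `x₀`. Unlike its definition, which uses a chart
that varies with the point, this formula is visibly continuous. -/
lemma secondForm_eq [IsManifold (𝓡 2) ∞ N'] (hi : IsIsometricEmbedding i) {x₀ x : N'}
    (hx : x ∈ (extChartAt (𝓡 2) x₀).source) (X : EuclideanSpace ℝ (Fin k)) :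
    secondForm i x X =
      fderiv ℝ (fderiv ℝ (chartRep i x₀)) (extChartAt (𝓡 2) x₀ x)
          (pinv (chartDeriv i x₀ x) X) (pinv (chartDeriv i x₀ x) X) -
        chartDeriv i x₀ x (pinv (chartDeriv i x₀ x)
          (fderiv ℝ (fderiv ℝ (chartRep i x₀)) (extChartAt (𝓡 2) x₀ x)
            (pinv (chartDeriv i x₀ x) X) (pinv (chartDeriv i x₀ x) X))) := by
  obtain ⟨hinj, hrange⟩ := range_differential hi hx
  have hmem := sub_differential_tangentLift_mem hi x X
  rw [hrange] at hmem
  have hT := pinv_eq_of_sub_mem hmem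
  set V : EuclideanSpace ℝ (Fin 2) := tangentLift i x X
  have hV : differential i x V =
      chartDeriv i x₀ x (fderiv ℝ (transition x₀ x) (extChartAt (𝓡 2) x x) V) :=
    congrArg (fun S : EuclideanSpace ℝ (Fin 2) →L[ℝ] EuclideanSpace ℝ (Fin k) => S V)
      (differential_eq_comp hi.smooth hx)
  replace hT : pinv (chartDeriv i x₀ x) X =
      fderiv ℝ (transition x₀ x) (extChartAt (𝓡 2) x x) V :=
    hT.trans ((congrArg _ hV).trans (pinv_apply_apply hinj _))
  obtain ⟨Z, hZ⟩ := fderiv_fderiv_chartRep hi.smooth hx V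
  have hZ0 : (LinearMap.range (chartDeriv i x₀ x).toLinearMap)ᗮ.starProjection
      (chartDeriv i x₀ x Z) = 0 := by
    rw [starProjection_range_orthogonal hinj, pinv_apply_apply hinj, sub_self]
  have hproj : ∀ Y, (LinearMap.range (differential i x).toLinearMap)ᗮ.starProjection Y =
      (LinearMap.range (chartDeriv i x₀ x).toLinearMap)ᗮ.starProjection Y := fun Y => by
    simp only [hrange]
  rw [← starProjection_range_orthogonal hinj, hT]
  refine (hproj _).trans ?_
  refine (congrArg _ hZ).trans ?_
  rw [map_add, hZ0, add_zero]

lemma continuous_secondForm [IsManifold (𝓡 2) ∞ N'] (hi : IsIsometricEmbedding i) :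
    Continuous fun q : N' × EuclideanSpace ℝ (Fin k) => secondForm i q.1 q.2 := by
  rw [continuous_iff_continuousAt]
  rintro ⟨x₀, X₀⟩
  have hx₀ : x₀ ∈ (extChartAt (𝓡 2) x₀).source := mem_extChartAt_source x₀
  have hev : ∀ᶠ q : N' × EuclideanSpace ℝ (Fin k) in 𝓝 (x₀, X₀),
      q.1 ∈ (extChartAt (𝓡 2) x₀).source :=
    continuous_fst.continuousAt.eventually ((isOpen_extChartAt_source x₀).mem_nhds hx₀)
  refine ContinuousAt.congr ?_ (hev.mono fun q hq => (secondForm_eq hi hq q.2).symm)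
  have hf := contDiffAt_chartRep hi.smooth hx₀
  have hφ : ContinuousAt (fun q : N' × EuclideanSpace ℝ (Fin k) => extChartAt (𝓡 2) x₀ q.1)
      (x₀, X₀) :=
    ContinuousAt.comp (f := fun q : N' × EuclideanSpace ℝ (Fin k) => q.1) (x := (x₀, X₀))
      (continuousAt_extChartAt (I := 𝓡 2) x₀) continuous_fst.continuousAt
  have hB : ContinuousAt (fun q : N' × EuclideanSpace ℝ (Fin k) => chartDeriv i x₀ q.1) (x₀, X₀) :=
    ContinuousAt.comp (f := fun q : N' × EuclideanSpace ℝ (Fin k) => extChartAt (𝓡 2) x₀ q.1)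
      (hf.fderiv_right (m := ∞) le_rfl).continuousAt hφ
  have hD : ContinuousAt (fun q : N' × EuclideanSpace ℝ (Fin k) =>
      fderiv ℝ (fderiv ℝ (chartRep i x₀)) (extChartAt (𝓡 2) x₀ q.1)) (x₀, X₀) :=
    ContinuousAt.comp (f := fun q : N' × EuclideanSpace ℝ (Fin k) => extChartAt (𝓡 2) x₀ q.1)
      (((hf.fderiv_right (m := ∞) le_rfl).fderiv_right (m := ∞) le_rfl).continuousAt) hφ
  have hP : ContinuousAt (fun q : N' × EuclideanSpace ℝ (Fin k) => pinv (chartDeriv i x₀ q.1))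
      (x₀, X₀) :=
    ContinuousAt.comp (f := fun q : N' × EuclideanSpace ℝ (Fin k) => chartDeriv i x₀ q.1)
      (continuousAt_pinv (range_differential hi hx₀).1) hB
  have hY := hP.clm_apply continuous_snd.continuousAt
  have hS := (hD.clm_apply hY).clm_apply hY
  exact hS.sub (hB.clm_apply (hP.clm_apply hS))

lemma exists_norm_secondForm_le [IsManifold (𝓡 2) ∞ N'] [CompactSpace N']
    (hi : IsIsometricEmbedding i) :
    ∃ C : ℝ, 0 ≤ C ∧ ∀ (x : N') (X : EuclideanSpace ℝ (Fin k)),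
      ‖secondForm i x X‖ ≤ C * ‖X‖ ^ 2 := by
  obtain ⟨C, hC⟩ := ((isCompact_univ (X := N')).prod
    (isCompact_sphere (0 : EuclideanSpace ℝ (Fin k)) 1)).exists_bound_of_continuousOn
      (continuous_secondForm hi).continuousOn
  refine ⟨max C 0, le_max_right _ _, fun x X => ?_⟩
  by_cases hX : X = 0
  · have := secondForm_smul (i := i) x 0 0
    simp only [smul_zero, ne_eq, OfNat.ofNat_ne_zero, not_false_eq_true, zero_pow, zero_smul]
      at this
    simp [hX, this]
  · have hX' : ‖X‖ ≠ 0 := by simpa using hX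
    have h1 := hC (x, ‖X‖⁻¹ • X) ⟨mem_univ _, by simp [norm_smul, hX']⟩
    have h2 := secondForm_smul (i := i) x ‖X‖ (‖X‖⁻¹ • X)
    rw [smul_smul, mul_inv_cancel₀ hX', one_smul] at h2
    rw [h2, norm_smul, norm_pow, norm_norm, mul_comm]
    gcongr
    exact h1.trans (le_max_left _ _)

/-- Chords of the compact surface `i(N')` are tangential up to a quadratic error. -/
lemma exists_inner_normal_le [IsManifold (𝓡 2) ∞ N'] [CompactSpace N']
    (hi : IsIsometricEmbedding i) :
    ∃ C : ℝ, 0 ≤ C ∧ ∀ (x y : N'), ∀ n ∈ (LinearMap.range (differential i x).toLinearMap)ᗮ,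
      |inner ℝ n (i y - i x)| ≤ C * ‖n‖ * ‖i y - i x‖ ^ 2 := by
  let P : Set (N' × N') → Prop := fun S => ∃ C : ℝ, 0 ≤ C ∧ ∀ q ∈ S,
    ∀ n ∈ (LinearMap.range (differential i q.1).toLinearMap)ᗮ,
      |inner ℝ n (i q.2 - i q.1)| ≤ C * ‖n‖ * ‖i q.2 - i q.1‖ ^ 2
  have hP : P univ := by
    refine isCompact_univ.induction_on (p := P) ⟨0, le_rfl, by simp⟩ ?_ ?_ ?_
    · rintro S T hST ⟨C, hC, h⟩
      exact ⟨C, hC, fun q hq => h q (hST hq)⟩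
    · rintro S T ⟨C, hC, h⟩ ⟨C', hC', h'⟩
      refine ⟨max C C', hC.trans (le_max_left _ _), ?_⟩
      rintro q (hq | hq) n hn
      · exact (h q hq n hn).trans (by gcongr; exact le_max_left _ _)
      · exact (h' q hq n hn).trans (by gcongr; exact le_max_right _ _)
    · rintro ⟨x₀, y₀⟩ -
      by_cases hxy : x₀ = y₀
      · -- near the diagonal: the Taylor estimate in the chart at `x₀`
        subst hxy
        have hx₀ : x₀ ∈ (extChartAt (𝓡 2) x₀).source := mem_extChartAt_source x₀
        obtain ⟨C, hC⟩ := eventually_taylor_le_sq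
          ((contDiffAt_chartRep hi.smooth hx₀).of_le ENat.LEInfty.out) (range_differential hi hx₀).1
        have hφ : ContinuousAt (fun q : N' × N' =>
            (extChartAt (𝓡 2) x₀ q.1, extChartAt (𝓡 2) x₀ q.2)) (x₀, x₀) :=
          (ContinuousAt.comp (f := fun q : N' × N' => q.1) (x := (x₀, x₀))
              (continuousAt_extChartAt (I := 𝓡 2) x₀) continuous_fst.continuousAt).prodMk
            (ContinuousAt.comp (f := fun q : N' × N' => q.2) (x := (x₀, x₀))
              (continuousAt_extChartAt (I := 𝓡 2) x₀) continuous_snd.continuousAt)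
        have hs := (isOpen_extChartAt_source (I := 𝓡 2) x₀).mem_nhds hx₀
        refine ⟨_, mem_nhdsWithin_of_mem_nhds ((hφ.eventually hC).and (prod_mem_nhds hs hs)),
          max C 0, le_max_right _ _, ?_⟩
        rintro ⟨x, y⟩ ⟨h, hx, hy⟩ n hn
        simp only [chartRep, Function.comp_apply, (extChartAt (𝓡 2) x₀).left_inv hx,
          (extChartAt (𝓡 2) x₀).left_inv hy] at h
        rw [(range_differential hi hx).2] at hn
        have h0 : inner ℝ n (chartDeriv i x₀ x
            (extChartAt (𝓡 2) x₀ y - extChartAt (𝓡 2) x₀ x)) = 0 := by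
          rw [real_inner_comm]; exact hn _ ⟨_, rfl⟩
        have h1 : inner ℝ n (i y - i x) = inner ℝ n (i y - i x - chartDeriv i x₀ x
            (extChartAt (𝓡 2) x₀ y - extChartAt (𝓡 2) x₀ x)) := by
          rw [inner_sub_right n (i y - i x), h0, sub_zero]
        calc |inner ℝ n (i y - i x)| ≤ ‖n‖ * (C * ‖i y - i x‖ ^ 2) := by
              rw [h1]
              refine (abs_real_inner_le_norm _ _).trans ?_
              gcongr
              exact h
          _ ≤ ‖n‖ * (max C 0 * ‖i y - i x‖ ^ 2) := by gcongr; exact le_max_left _ _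
          _ = _ := by ring
      · -- away from the diagonal: `‖i y - i x‖` is bounded below
        have hne : 0 < ‖i y₀ - i x₀‖ := by
          rw [norm_pos_iff, sub_ne_zero]
          exact fun h => hxy (hi.isEmbedding.injective h).symm
        have hcont : Continuous fun q : N' × N' => ‖i q.2 - i q.1‖ :=
          ((hi.isEmbedding.continuous.comp continuous_snd).sub
            (hi.isEmbedding.continuous.comp continuous_fst)).norm
        have hev : ∀ᶠ q in 𝓝 (x₀, y₀), ‖i y₀ - i x₀‖ / 2 < ‖i q.2 - i q.1‖ :=
          hcont.continuousAt.eventually (lt_mem_nhds (half_lt_self hne))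
        refine ⟨_, mem_nhdsWithin_of_mem_nhds hev, 2 / ‖i y₀ - i x₀‖, by positivity, ?_⟩
        intro q hq n _
        have hq' : ‖i y₀ - i x₀‖ / 2 < ‖i q.2 - i q.1‖ := hq
        refine (abs_real_inner_le_norm _ _).trans ?_
        have h1 : 1 ≤ 2 / ‖i y₀ - i x₀‖ * ‖i q.2 - i q.1‖ := by
          rw [div_mul_eq_mul_div, le_div_iff₀ hne]; linarith
        calc ‖n‖ * ‖i q.2 - i q.1‖ = 1 * (‖n‖ * ‖i q.2 - i q.1‖) := by ring
          _ ≤ (2 / ‖i y₀ - i x₀‖ * ‖i q.2 - i q.1‖) * (‖n‖ * ‖i q.2 - i q.1‖) := by gcongr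
          _ = _ := by ring
  obtain ⟨C, hC, h⟩ := hP
  exact ⟨C, hC, fun x y => h (x, y) (mem_univ _)⟩

lemma exists_secondForm_bounds [IsManifold (𝓡 2) ∞ N'] [CompactSpace N']
    (hi : IsIsometricEmbedding i) :
    ∃ C : ℝ, 0 < C ∧ (∀ (x : N') (X : EuclideanSpace ℝ (Fin k)),
        ‖secondForm i x X‖ ≤ C * ‖X‖ ^ 2) ∧
      ∀ (x y : N') (X : EuclideanSpace ℝ (Fin k)),
        |inner ℝ (secondForm i x X) (i y - i x)| ≤ C * ‖X‖ ^ 2 * ‖i y - i x‖ ^ 2 := by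
  obtain ⟨C, hC, h⟩ := exists_norm_secondForm_le hi
  obtain ⟨C', hC', h'⟩ := exists_inner_normal_le hi
  refine ⟨C + C' * C + 1, by positivity, fun x X => (h x X).trans ?_, fun x y X => ?_⟩
  · gcongr; nlinarith [mul_nonneg hC' hC]
  · refine (h' x y _ (secondForm_mem x X)).trans (mul_le_mul_of_nonneg_right ?_ (by positivity))
    calc C' * ‖secondForm i x X‖ ≤ C' * (C * ‖X‖ ^ 2) := by gcongr; exact h x X
      _ ≤ _ := by rw [← mul_assoc]; gcongr; linarith

end Isometric

/-! ### Convergence in `L^p` -/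

section Lp

variable {α F F₁ F₂ F₃ : Type*} [MeasurableSpace α] {μ : Measure α}
  [NormedAddCommGroup F] [NormedAddCommGroup F₁] [NormedSpace ℝ F₁]
  [NormedAddCommGroup F₂] [NormedSpace ℝ F₂] [NormedAddCommGroup F₃] [NormedSpace ℝ F₃]
  {p : ℝ≥0∞}

lemma tendsto_eLpNorm_zero_of_dominated (hp0 : p ≠ 0) (hp : p ≠ ⊤) {f : ℕ → α → F} {g : α → F₁}
    (hf : ∀ n, AEStronglyMeasurable (f n) μ) (hg : MemLp g p μ) {c : ℝ}
    (hle : ∀ n, ∀ᵐ x ∂μ, ‖f n x‖ ≤ c * ‖g x‖)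
    (hlim : ∀ᵐ x ∂μ, Tendsto (fun n => f n x) atTop (𝓝 0)) :
    Tendsto (fun n => eLpNorm (f n) p μ) atTop (𝓝 0) := by
  have hpos : 0 < p.toReal := ENNReal.toReal_pos hp0 hp
  simp only [eLpNorm_eq_lintegral_rpow_enorm_toReal hp0 hp]
  have hcg : MemLp (fun x => c • g x) p μ := hg.const_smul c
  have h := tendsto_lintegral_of_dominated_convergence' (μ := μ)
    (F := fun n x => ‖f n x‖ₑ ^ p.toReal) (f := fun _ => 0) (fun x => ‖c • g x‖ₑ ^ p.toReal)
    (fun n => (hf n).enorm.pow_const _) (fun n => ?_) ?_ ?_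
  · simp only [lintegral_zero] at h
    have h2 := (ENNReal.continuous_rpow_const (y := 1 / p.toReal)).tendsto 0 |>.comp h
    simpa [Function.comp_def, ENNReal.zero_rpow_of_pos (inv_pos.2 hpos)] using h2
  · filter_upwards [hle n] with x hx
    gcongr
    rw [← ofReal_norm, ← ofReal_norm]
    refine ENNReal.ofReal_le_ofReal (hx.trans ?_)
    rw [norm_smul]
    gcongr
    exact le_abs_self c
  · have := hcg.eLpNorm_ne_top
    rw [eLpNorm_eq_lintegral_rpow_enorm_toReal hp0 hp] at this
    intro htop
    rw [htop, ENNReal.top_rpow_of_pos (by positivity)] at this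
    exact this rfl
  · filter_upwards [hlim] with x hx
    have h2 := (ENNReal.continuous_rpow_const (y := p.toReal)).tendsto 0 |>.comp
      ((continuous_enorm.tendsto (0 : F)).comp hx |>.trans (by simp))
    simpa [Function.comp_def, ENNReal.zero_rpow_of_pos hpos] using h2

/-- Products `B (m n) (g n)` converge in `L^p` if the first factors are uniformly bounded and
converge in some `L^r`, while the second factors converge in `L^p`. -/
lemma tendsto_eLpNorm_bilinear (hp1 : 1 ≤ p) (hp : p ≠ ⊤) {r : ℝ≥0∞} (hr : r ≠ 0)
    (B : F₁ →L[ℝ] F₂ →L[ℝ] F₃)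
    {m : ℕ → α → F₁} {m' : α → F₁} {g : ℕ → α → F₂} {g' : α → F₂} {K : ℝ}
    (hm : ∀ n, AEStronglyMeasurable (m n) μ) (hm' : AEStronglyMeasurable m' μ)
    (hmK : ∀ n, ∀ᵐ x ∂μ, ‖m n x‖ ≤ K) (hmK' : ∀ᵐ x ∂μ, ‖m' x‖ ≤ K)
    (hg : ∀ n, AEStronglyMeasurable (g n) μ) (hg' : MemLp g' p μ)
    (hmlim : Tendsto (fun n => eLpNorm (fun x => m n x - m' x) r μ) atTop (𝓝 0))
    (hglim : Tendsto (fun n => eLpNorm (fun x => g n x - g' x) p μ) atTop (𝓝 0)) :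
    Tendsto (fun n => eLpNorm (fun x => B (m n x) (g n x) - B (m' x) (g' x)) p μ)
      atTop (𝓝 0) := by
  have hp0 : p ≠ 0 := (zero_lt_one.trans_le hp1).ne'
  have hmeas : ∀ {a : α → F₁} {b : α → F₂}, AEStronglyMeasurable a μ → AEStronglyMeasurable b μ →
      AEStronglyMeasurable (fun x => B (a x) (b x)) μ := fun ha hb =>
    B.aestronglyMeasurable_comp₂ ha hb
  have h1 : Tendsto (fun n => eLpNorm (fun x => B (m n x) (g n x - g' x)) p μ) atTop (𝓝 0) := by
    have hle : ∀ n, eLpNorm (fun x => B (m n x) (g n x - g' x)) p μ ≤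
        ENNReal.ofReal (‖B‖ * K) * eLpNorm (fun x => g n x - g' x) p μ := fun n => by
      refine eLpNorm_le_mul_eLpNorm_of_ae_le_mul ?_ p
      filter_upwards [hmK n] with x hx
      exact (B.le_opNorm₂ _ _).trans (by gcongr)
    refine tendsto_of_tendsto_of_tendsto_of_le_of_le tendsto_const_nhds ?_ (fun _ => zero_le) hle
    simpa only [mul_zero] using ENNReal.Tendsto.const_mul hglim (Or.inr ENNReal.ofReal_ne_top)
  have h2 : Tendsto (fun n => eLpNorm (fun x => B (m n x - m' x) (g' x)) p μ) atTop (𝓝 0) := by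
    refine tendsto_of_subseq_tendsto fun ns hns => ?_
    obtain ⟨ms, -, hae⟩ := (tendstoInMeasure_of_tendsto_eLpNorm (f := fun n => m (ns n)) hr
      (fun n => hm _) hm' (hmlim.comp hns)).exists_seq_tendsto_ae
    refine ⟨ms, tendsto_eLpNorm_zero_of_dominated hp0 hp (g := g') (c := ‖B‖ * (K + K))
      (fun n => hmeas ((hm _).sub hm') hg'.1) hg' (fun n => ?_) ?_⟩
    · filter_upwards [hmK (ns (ms n)), hmK'] with x hx hx'
      refine (B.le_opNorm₂ _ _).trans ?_
      gcongr
      exact (norm_sub_le _ _).trans (by gcongr)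
    · filter_upwards [hae] with x hx
      have := ((B.flip (g' x)).continuous.tendsto _).comp (hx.sub_const (m' x))
      simpa [Function.comp_def] using this
  refine tendsto_of_tendsto_of_tendsto_of_le_of_le tendsto_const_nhds
    (by simpa only [add_zero] using h1.add h2) (fun _ => zero_le) fun n => ?_
  have h3 : (fun x => B (m n x) (g n x) - B (m' x) (g' x)) =
      (fun x => B (m n x) (g n x - g' x)) + fun x => B (m n x - m' x) (g' x) := by
    ext x
    simp
  rw [h3]
  exact eLpNorm_add_le (f := fun x => B (m n x) (g n x - g' x))
    (g := fun x => B (m n x - m' x) (g' x)) (hmeas (hm n) ((hg n).sub hg'.1))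
    (hmeas ((hm n).sub hm') hg'.1) hp1

-- Several of the following facts restate library lemmas for values in an abstract normed group:
-- for spaces of continuous linear maps, unifying the topologies in the general forms is costly.

lemma memLp_indicator {s : Set α} (hs : MeasurableSet s) {f : α → F}
    (hf : MemLp f p (μ.restrict s)) : MemLp (s.indicator f) p μ :=
  (memLp_indicator_iff_restrict hs).2 hf

lemma eLpNorm_restrict_le (s : Set α) (f : α → F) : eLpNorm f p (μ.restrict s) ≤ eLpNorm f p μ :=
  eLpNorm_mono_measure f Measure.restrict_le_self

lemma eLpNorm_restrict_eq {s : Set α} {f : α → F} (hf : Function.support f ⊆ s) :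
    eLpNorm f p (μ.restrict s) = eLpNorm f p μ :=
  eLpNorm_restrict_eq_of_support_subset hf

lemma memLp_add {f g : α → F} (hf : MemLp f p μ) (hg : MemLp g p μ) :
    MemLp (fun x => f x + g x) p μ :=
  hf.add hg

lemma tendsto_eLpNorm_sub_self (m : α → F) :
    Tendsto (fun _ : ℕ => eLpNorm (fun x => m x - m x) p μ) atTop (𝓝 0) := by
  simp

lemma MemLp.bilinear (B : F₁ →L[ℝ] F₂ →L[ℝ] F₃) {m : α → F₁} {g : α → F₂} {K : ℝ}
    (hm : AEStronglyMeasurable m μ) (hmK : ∀ᵐ x ∂μ, ‖m x‖ ≤ K) (hg : MemLp g p μ) :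
    MemLp (fun x => B (m x) (g x)) p μ := by
  refine hg.of_le_mul (c := ‖B‖ * K) (B.aestronglyMeasurable_comp₂ hm hg.1) ?_
  filter_upwards [hmK] with x hx
  exact (B.le_opNorm₂ _ _).trans (by gcongr)

lemma tendsto_eLpNorm_add (hp1 : 1 ≤ p) {f g : ℕ → α → F} {f' g' : α → F}
    (hf : ∀ n, AEStronglyMeasurable (f n) μ) (hf' : AEStronglyMeasurable f' μ)
    (hg : ∀ n, AEStronglyMeasurable (g n) μ) (hg' : AEStronglyMeasurable g' μ)
    (hflim : Tendsto (fun n => eLpNorm (fun x => f n x - f' x) p μ) atTop (𝓝 0))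
    (hglim : Tendsto (fun n => eLpNorm (fun x => g n x - g' x) p μ) atTop (𝓝 0)) :
    Tendsto (fun n => eLpNorm (fun x => (f n x + g n x) - (f' x + g' x)) p μ) atTop (𝓝 0) := by
  refine tendsto_of_tendsto_of_tendsto_of_le_of_le tendsto_const_nhds
    (by simpa using hflim.add hglim) (fun _ => zero_le) fun n => ?_
  have h3 : (fun x => (f n x + g n x) - (f' x + g' x)) =
      (fun x => f n x - f' x) + fun x => g n x - g' x := by
    ext x
    simp only [Pi.add_apply]
    abel
  rw [h3]
  exact eLpNorm_add_le (f := fun x => f n x - f' x) (g := fun x => g n x - g' x)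
    ((hf n).sub hf') ((hg n).sub hg') hp1

end Lp

/-! ### Mollification -/

section Mollify

variable {F : Type*} [NormedAddCommGroup F] [NormedSpace ℝ F]

/-- The convolution of `f` with the smooth probability density proportional to the bump
function `φ`. -/
def mollify (φ : ContDiffBump (0 : ℂ)) (f : ℂ → F) : ℂ → F :=
  convolution (φ.normed volume) f (ContinuousLinearMap.lsmul ℝ ℝ) volume

lemma mollify_apply (φ : ContDiffBump (0 : ℂ)) (f : ℂ → F) (x : ℂ) :
    mollify φ f x = ∫ t, φ.normed volume t • f (x - t) := rfl

lemma contDiff_mollify (φ : ContDiffBump (0 : ℂ)) {f : ℂ → F} (hf : LocallyIntegrable f) :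
    ContDiff ℝ ∞ (mollify φ f) :=
  φ.hasCompactSupport_normed.contDiff_convolution_left _ φ.contDiff_normed hf

/-- Mollification is a contraction of `L^p`, by Jensen's inequality and Tonelli's theorem. -/
lemma eLpNorm_mollify_le {p : ℝ≥0∞} (hp1 : 1 ≤ p) (hp : p ≠ ⊤) (φ : ContDiffBump (0 : ℂ))
    {f : ℂ → F} (hf : AEStronglyMeasurable f volume) :
    eLpNorm (mollify φ f) p volume ≤ eLpNorm f p volume := by
  wlog hfm : StronglyMeasurable f generalizing f
  · have h := this hf.stronglyMeasurable_mk.aestronglyMeasurable hf.stronglyMeasurable_mk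
    rw [eLpNorm_congr_ae hf.ae_eq_mk]
    have h2 : mollify φ f = mollify φ (hf.mk f) :=
      convolution_congr _ (Filter.EventuallyEq.refl _ _) hf.ae_eq_mk
    rwa [h2]
  have hp0 : p ≠ 0 := (zero_lt_one.trans_le hp1).ne'
  have hpos : 0 < p.toReal := ENNReal.toReal_pos hp0 hp
  have hp1' : 1 ≤ p.toReal := by
    have := (ENNReal.toReal_le_toReal (by simp) hp).2 hp1
    simpa using this
  have hρc : Continuous (φ.normed volume) := φ.continuous_normed
  set ρ : ℂ → ℝ≥0∞ := fun t => ‖φ.normed volume t‖ₑ with hρ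
  have hρm : Measurable ρ := hρc.enorm.measurable
  have hρ1 : ∫⁻ t, ρ t = 1 := by
    have h := φ.integral_normed (μ := volume)
    have h2 := ofReal_integral_eq_lintegral_ofReal (μ := volume) φ.integrable_normed
      (ae_of_all _ fun t => φ.nonneg_normed t)
    rw [h, ENNReal.ofReal_one] at h2
    rw [h2]
    refine lintegral_congr fun t => ?_
    rw [hρ]
    simp only
    rw [← ofReal_norm, Real.norm_of_nonneg (φ.nonneg_normed t)]
  set ν : Measure ℂ := volume.withDensity ρ
  have : IsProbabilityMeasure ν := ⟨by
    rw [withDensity_apply _ MeasurableSet.univ, Measure.restrict_univ, hρ1]⟩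
  have hjm : Measurable fun q : ℂ × ℂ => ‖f (q.1 - q.2)‖ₑ ^ p.toReal :=
    ((hfm.comp_measurable (measurable_fst.sub measurable_snd)).enorm).pow_const _
  have hjensen : ∀ x, ‖mollify φ f x‖ₑ ^ p.toReal ≤ ∫⁻ t, ‖f (x - t)‖ₑ ^ p.toReal ∂ν := by
    intro x
    have hxm : StronglyMeasurable fun t => f (x - t) :=
      hfm.comp_measurable (measurable_const.sub measurable_id)
    have h1 : ‖mollify φ f x‖ₑ ≤ ∫⁻ t, ‖f (x - t)‖ₑ ∂ν := by
      rw [mollify_apply, lintegral_withDensity_eq_lintegral_mul _ hρm hxm.enorm]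
      refine (enorm_integral_le_lintegral_enorm _).trans (le_of_eq ?_)
      exact lintegral_congr fun t => enorm_smul _ _
    have h2 := eLpNorm'_le_eLpNorm'_of_exponent_le zero_lt_one hp1' ν hxm.aestronglyMeasurable
    simp only [eLpNorm', ENNReal.rpow_one, div_one] at h2
    have h3 := ENNReal.rpow_le_rpow (h1.trans h2) hpos.le
    rwa [← ENNReal.rpow_mul, one_div, inv_mul_cancel₀ hpos.ne', ENNReal.rpow_one] at h3
  rw [eLpNorm_eq_lintegral_rpow_enorm_toReal hp0 hp, eLpNorm_eq_lintegral_rpow_enorm_toReal hp0 hp]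
  refine ENNReal.rpow_le_rpow ?_ (by positivity)
  calc ∫⁻ x, ‖mollify φ f x‖ₑ ^ p.toReal ≤ ∫⁻ x, ∫⁻ t, ‖f (x - t)‖ₑ ^ p.toReal ∂ν :=
        lintegral_mono hjensen
    _ = ∫⁻ t, (∫⁻ x, ‖f (x - t)‖ₑ ^ p.toReal) ∂ν := lintegral_lintegral_swap hjm.aemeasurable
    _ = ∫⁻ _, (∫⁻ x, ‖f x‖ₑ ^ p.toReal) ∂ν := by
        refine lintegral_congr fun t => ?_
        exact lintegral_sub_right_eq_self (fun x => ‖f x‖ₑ ^ p.toReal) t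
    _ = _ := by simp

variable [CompleteSpace F]

lemma norm_mollify_sub_le (φ : ContDiffBump (0 : ℂ)) {f : ℂ → F} {M : ℝ}
    (hf : AEStronglyMeasurable f volume) (hM : ∀ x, ‖f x‖ ≤ M) (x : ℂ) :
    ‖mollify φ f x - f x‖ ≤ M + M := by
  rw [← dist_eq_norm]
  refine ContDiffBump.dist_normed_convolution_le hf fun y _ => ?_
  rw [dist_eq_norm]
  exact (norm_sub_le _ _).trans (add_le_add (hM y) (hM x))

/-- Mollifications of `f ∈ L^p` converge to `f` in `L^p`: this holds for continuous functions with
compact support, which are dense, and mollification is a contraction. -/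
lemma tendsto_eLpNorm_mollify_sub {p : ℝ≥0∞} (hp1 : 1 ≤ p) (hp : p ≠ ⊤)
    {φ : ℕ → ContDiffBump (0 : ℂ)} (hφ : Tendsto (fun n => (φ n).rOut) atTop (𝓝 0))
    (hφ1 : ∀ n, (φ n).rOut ≤ 1) {f : ℂ → F} (hf : MemLp f p volume) :
    Tendsto (fun n => eLpNorm (fun x => mollify (φ n) f x - f x) p volume) atTop (𝓝 0) := by
  have hp0 : p ≠ 0 := (zero_lt_one.trans_le hp1).ne'
  have hcc : ∀ g : ℂ → F, HasCompactSupport g → Continuous g →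
      Tendsto (fun n => eLpNorm (fun x => mollify (φ n) g x - g x) p volume) atTop (𝓝 0) := by
    intro g hgc hg
    obtain ⟨M, hM⟩ := hgc.exists_bound_of_continuous hg
    obtain ⟨R, hR⟩ := hgc.isCompact.isBounded.subset_closedBall 0
    have hM0 : 0 ≤ M := (norm_nonneg _).trans (hM 0)
    have hind : MemLp ((Metric.closedBall (0 : ℂ) (R + 1)).indicator fun _ => (1 : ℝ)) p volume :=
      memLp_indicator_const p measurableSet_closedBall 1 (Or.inr measure_closedBall_lt_top.ne)
    refine tendsto_eLpNorm_zero_of_dominated hp0 hp (c := M + M) (fun n =>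
      ((contDiff_mollify (φ n) hg.locallyIntegrable).continuous.sub hg).aestronglyMeasurable)
      hind (fun n => ae_of_all _ fun x => ?_) (ae_of_all _ fun x => ?_)
    · by_cases hx : x ∈ Metric.closedBall (0 : ℂ) (R + 1)
      · simpa [hx] using norm_mollify_sub_le (φ n) hg.aestronglyMeasurable hM x
      · have hzero : ∀ y ∈ Metric.ball x (φ n).rOut, g y = 0 := fun y hy => by
          by_contra hne
          refine hx ?_
          have h1 := hR (subset_tsupport _ hne)
          rw [mem_closedBall_zero_iff] at h1 ⊢
          rw [mem_ball_iff_norm, norm_sub_rev] at hy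
          have h2 := norm_le_norm_add_norm_sub' x y
          linarith [hφ1 n]
        have hx0 : g x = 0 := hzero x (Metric.mem_ball_self (φ n).rOut_pos)
        have : mollify (φ n) g x = g x :=
          ContDiffBump.normed_convolution_eq_right fun y hy => by rw [hzero y hy, hx0]
        simp [hx, this]
    · have := ContDiffBump.convolution_tendsto_right_of_continuous (μ := volume) hφ hg x
      simpa [mollify] using this.sub_const (g x)
  rw [ENNReal.tendsto_nhds_zero]
  intro ε hε
  have hε3 : ε / 3 ≠ 0 := (ENNReal.div_pos hε.ne' (by simp)).ne'
  obtain ⟨g, hgc, hfg, hg, hgp⟩ := hf.exists_hasCompactSupport_eLpNorm_sub_le hp hε3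
  filter_upwards [(ENNReal.tendsto_nhds_zero.1 (hcc g hgc hg)) (ε / 3)
    (pos_iff_ne_zero.2 hε3)] with n hn
  have hfgm : AEStronglyMeasurable (f - g) volume := hf.1.sub hgp.1
  have hfgL : LocallyIntegrable (f - g) volume := (hf.sub hgp).locallyIntegrable hp1
  have hmol : mollify (φ n) f = mollify (φ n) (f - g) + mollify (φ n) g := by
    ext x
    have h := ConvolutionExistsAt.distrib_add (L := ContinuousLinearMap.lsmul ℝ ℝ) (μ := volume)
      (((φ n).hasCompactSupport_normed (μ := volume)).convolutionExists_left
        (ContinuousLinearMap.lsmul ℝ ℝ)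
        (φ n).continuous_normed hfgL x)
      (((φ n).hasCompactSupport_normed (μ := volume)).convolutionExists_left
        (ContinuousLinearMap.lsmul ℝ ℝ)
        (φ n).continuous_normed (hg.locallyIntegrable (μ := volume)) x)
    rw [sub_add_cancel] at h
    exact h
  have hsplit : (fun x => mollify (φ n) f x - f x) =
      (mollify (φ n) (f - g) + fun x => mollify (φ n) g x - g x) - (f - g) := by
    ext x
    simp only [hmol, Pi.add_apply, Pi.sub_apply]
    abel
  have hm1 : AEStronglyMeasurable (mollify (φ n) (f - g)) volume :=
    (contDiff_mollify (φ n) hfgL).continuous.aestronglyMeasurable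
  have hm2 : AEStronglyMeasurable (fun x => mollify (φ n) g x - g x) volume :=
    ((contDiff_mollify (φ n) hg.locallyIntegrable).continuous.sub hg).aestronglyMeasurable
  rw [hsplit]
  calc _ ≤ eLpNorm (mollify (φ n) (f - g) + fun x => mollify (φ n) g x - g x) p volume +
        eLpNorm (f - g) p volume := eLpNorm_sub_le (hm1.add hm2) hfgm hp1
    _ ≤ (eLpNorm (mollify (φ n) (f - g)) p volume +
        eLpNorm (fun x => mollify (φ n) g x - g x) p volume) + eLpNorm (f - g) p volume := by
        gcongr; exact eLpNorm_add_le hm1 hm2 hp1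
    _ ≤ (ε / 3 + ε / 3) + ε / 3 := by
        gcongr
        exact (eLpNorm_mollify_le hp1 hp (φ n) hfgm).trans hfg
    _ = ε := ENNReal.add_thirds ε

end Mollify

/-! ### Approximation of Sobolev functions by test functions -/

section Approximation

variable {F : Type*} [NormedAddCommGroup F] [NormedSpace ℝ F] {Ω : Set ℂ}

lemma IsTestFunction.exists_bound {φ : ℂ → F} (hφ : IsTestFunction Ω φ) :
    ∃ K, ∀ z, ‖φ z‖ ≤ K :=
  hφ.2.1.exists_bound_of_continuous hφ.1.continuous

lemma IsTestFunction.exists_fderiv_bound {φ : ℂ → F} (hφ : IsTestFunction Ω φ) :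
    ∃ K, ∀ z, ‖fderiv ℝ φ z‖ ≤ K :=
  (hφ.2.1.fderiv ℝ).exists_bound_of_continuous (hφ.1.continuous_fderiv (by simp))

lemma locallyIntegrableOn_apply {H : ℂ → ℂ →L[ℝ] F} (hH : LocallyIntegrableOn H Ω) (h : ℂ) :
    LocallyIntegrableOn (fun z => H z h) Ω := fun z hz => by
  obtain ⟨U, hU, hint⟩ := hH z hz
  exact ⟨U, hU, hint.apply_continuousLinearMap h⟩

lemma integrableOn_smul_of_isTestFunction (hΩ : IsOpen Ω) {v : ℂ → F}
    (hv : LocallyIntegrableOn v Ω) {φ : ℂ → ℝ} (hφ : IsTestFunction Ω φ) :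
    IntegrableOn (fun z => φ z • v z) Ω := by
  have h1 : IntegrableOn (fun z => φ z • v z) (tsupport φ) :=
    (hv.integrableOn_compact_subset hφ.2.2 hφ.2.1.isCompact).continuousOn_smul
      hφ.1.continuous.continuousOn hφ.2.1.isCompact
  refine h1.of_forall_sdiff_eq_zero hΩ.measurableSet fun z hz => ?_
  rw [image_eq_zero_of_notMem_tsupport hz.2, zero_smul]

/-- By the fundamental lemma of the calculus of variations, applied in the directions
`1` and `I`. -/
lemma weakDifferential_unique [CompleteSpace F] (hΩ : IsOpen Ω) {v : ℂ → F}
    {G G' : ℂ → ℂ →L[ℝ] F} (hG : HasWeakDifferential Ω v G) (hG' : HasWeakDifferential Ω v G') :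
    ∀ᵐ z ∂(volume.restrict Ω), G z = G' z := by
  rw [ae_restrict_iff' hΩ.measurableSet]
  have key : ∀ h : ℂ, ∀ᵐ z, z ∈ Ω → G z h - G' z h = 0 := by
    intro h
    have hint : ∀ {H : ℂ → ℂ →L[ℝ] F}, LocallyIntegrableOn H Ω → ∀ φ : ℂ → ℝ,
        IsTestFunction Ω φ → IntegrableOn (fun z => φ z • H z h) Ω := fun hH φ hφ =>
      integrableOn_smul_of_isTestFunction hΩ (locallyIntegrableOn_apply hH h) hφ
    refine hΩ.ae_eq_zero_of_integral_contDiff_smul_eq_zero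
      ((locallyIntegrableOn_apply hG.2.1 h).sub (locallyIntegrableOn_apply hG'.2.1 h)) ?_
    intro φ hφ1 hφ2 hφ3
    have hφ : IsTestFunction Ω φ := ⟨hφ1, hφ2, hφ3⟩
    have hset : ∫ z, φ z • (G z h - G' z h) = ∫ z in Ω, φ z • (G z h - G' z h) := by
      refine (setIntegral_eq_integral_of_forall_compl_eq_zero fun z hz => ?_).symm
      rw [image_eq_zero_of_notMem_tsupport fun h => hz (hφ3 h), zero_smul]
    refine hset.trans ?_
    simp only [smul_sub]
    rw [integral_sub (hint hG.2.1 φ hφ) (hint hG'.2.1 φ hφ), sub_eq_zero, ← neg_inj,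
      ← hG.2.2 φ hφ h, ← hG'.2.2 φ hφ h]
  filter_upwards [key 1, key Complex.I] with z h1 hI hz
  ext w
  have hw : w = w.re • (1 : ℂ) + w.im • Complex.I := by
    simp [Complex.re_add_im]
  rw [hw, map_add, map_add, map_smul, map_smul, map_smul, map_smul,
    sub_eq_zero.1 (h1 hz), sub_eq_zero.1 (hI hz)]

/-- A bounded function of `W^{1,p}_0` is the limit in `W^{1,p}` of a bounded sequence of test
functions: compose an approximating sequence with a smooth map of compact support that is the
identity on a large ball. -/
lemma IsSobolevZero.exists_bounded_approx [FiniteDimensional ℝ F] {p : ℝ} (hp : 1 ≤ p) {η : ℂ → F}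
    (hη : IsSobolevZero Ω p η) {R : ℝ} (hR : 0 ≤ R)
    (hηR : ∀ᵐ z ∂(volume.restrict Ω), ‖η z‖ ≤ R) :
    ∃ (G : ℂ → ℂ →L[ℝ] F) (θ : ℕ → ℂ → F) (K : ℝ), IsSobolev Ω p η G ∧
      (∀ n, IsTestFunction Ω (θ n)) ∧ (∀ n z, ‖θ n z‖ ≤ K) ∧
      Tendsto (fun n => eLpNorm (fun z => θ n z - η z) (ENNReal.ofReal p) (volume.restrict Ω))
        atTop (𝓝 0) ∧
      Tendsto (fun n => eLpNorm (fun z => fderiv ℝ (θ n) z - G z) (ENNReal.ofReal p)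
        (volume.restrict Ω)) atTop (𝓝 0) := by
  obtain ⟨G, hG, φ, hφ, hlim, hlim'⟩ := hη
  have hp1 : 1 ≤ ENNReal.ofReal p := by simpa using ENNReal.ofReal_le_ofReal hp
  have hp0 : ENNReal.ofReal p ≠ 0 := (zero_lt_one.trans_le hp1).ne'
  let f : ContDiffBump (0 : F) := ⟨R + 1, R + 2, by linarith, by linarith⟩
  let T : F → F := fun y => f y • y
  have hT : ContDiff ℝ ∞ T := f.contDiff.smul contDiff_id
  have hTc : HasCompactSupport T := f.hasCompactSupport.smul_right
  have hTid : ∀ y ∈ Metric.ball (0 : F) (R + 1), T y = y := fun y hy => by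
    simp [T, f.one_of_mem_closedBall (Metric.ball_subset_closedBall hy)]
  have hT'id : ∀ y ∈ Metric.ball (0 : F) (R + 1),
      fderiv ℝ T y = ContinuousLinearMap.id ℝ F := fun y hy => by
    have : T =ᶠ[𝓝 y] id := by
      filter_upwards [Metric.isOpen_ball.mem_nhds hy] with y' hy' using hTid y' hy'
    rw [this.fderiv_eq, fderiv_id]
  have hT' : ContDiff ℝ ∞ (fderiv ℝ T) := hT.fderiv_right le_rfl
  have hηball : ∀ᵐ z ∂(volume.restrict Ω), η z ∈ Metric.ball (0 : F) (R + 1) := by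
    filter_upwards [hηR] with z hz
    rw [mem_ball_zero_iff]
    linarith
  obtain ⟨K, hK⟩ := hTc.exists_bound_of_continuous hT.continuous
  obtain ⟨K', hK'⟩ := (hTc.fderiv ℝ).exists_bound_of_continuous hT'.continuous
  obtain ⟨L, hL⟩ := hT.lipschitzWith_of_hasCompactSupport hTc (by simp)
  obtain ⟨L', hL'⟩ := hT'.lipschitzWith_of_hasCompactSupport (hTc.fderiv ℝ) (by simp)
  have hlip : ∀ {F' : Type _} [NormedAddCommGroup F'] {S : F → F'} {l : NNReal},
      LipschitzWith l S → Tendsto (fun n => eLpNorm (fun z => S (φ n z) - S (η z))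
        (ENNReal.ofReal p) (volume.restrict Ω)) atTop (𝓝 0) := by
    intro F' _ S l hS
    refine tendsto_of_tendsto_of_tendsto_of_le_of_le tendsto_const_nhds ?_ (fun _ => zero_le)
      fun n => eLpNorm_le_mul_eLpNorm_of_ae_le_mul (c := l)
        (ae_of_all _ fun z => hS.norm_sub_le (φ n z) (η z)) _
    simpa only [mul_zero] using ENNReal.Tendsto.const_mul hlim (Or.inr ENNReal.ofReal_ne_top)
  have hcomp : ∀ n z, fderiv ℝ (T ∘ φ n) z = (fderiv ℝ T (φ n z)).comp (fderiv ℝ (φ n) z) :=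
    fun n z => fderiv_comp z (hT.differentiable (by simp) _) ((hφ n).1.differentiable (by simp) z)
  refine ⟨G, fun n => T ∘ φ n, K, hG, fun n => ⟨hT.comp (hφ n).1, ?_, ?_⟩, fun n z => hK _, ?_, ?_⟩
  · exact (hφ n).2.1.comp_left (by simp [T])
  · exact (tsupport_comp_subset (by simp [T]) _).trans (hφ n).2.2
  · refine (hlip hL).congr fun n => eLpNorm_congr_ae ?_
    filter_upwards [hηball] with z hz
    rw [hTid _ hz, Function.comp_apply]
  · have h := tendsto_eLpNorm_bilinear (μ := volume.restrict Ω) hp1 ENNReal.ofReal_ne_top hp0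
      (ContinuousLinearMap.compL ℝ ℂ F F) (m := fun n z => fderiv ℝ T (φ n z))
      (m' := fun z => fderiv ℝ T (η z)) (g := fun n z => fderiv ℝ (φ n) z) (g' := G) (K := K')
      (fun n => (hT'.continuous.comp (hφ n).1.continuous).aestronglyMeasurable)
      (hT'.continuous.comp_aestronglyMeasurable hG.2.1.1) (fun n => ae_of_all _ fun z => hK' _)
      (ae_of_all _ fun z => hK' _)
      (fun n => ((hφ n).1.continuous_fderiv (by simp)).aestronglyMeasurable) hG.2.2 (hlip hL') hlim'
    refine h.congr fun n => eLpNorm_congr_ae ?_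
    filter_upwards [hηball] with z hz
    rw [hcomp, hT'id _ hz]
    rfl

/-- Where the ball of the mollifier stays inside `Ω`, mollification commutes with weak
differentiation. -/
lemma fderiv_mollify_indicator [CompleteSpace F] (hΩ : IsOpen Ω) {w : ℂ → F} {G : ℂ → ℂ →L[ℝ] F}
    (hG : HasWeakDifferential Ω w G) (hw : LocallyIntegrable (Ω.indicator w))
    (hG' : LocallyIntegrable (Ω.indicator G)) (φ : ContDiffBump (0 : ℂ)) {z : ℂ}
    (hz : Metric.closedBall z φ.rOut ⊆ Ω) :
    fderiv ℝ (mollify φ (Ω.indicator w)) z = mollify φ (Ω.indicator G) z := by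
  set ρ : ℂ → ℝ := φ.normed volume with hρ
  have hρs : ContDiff ℝ ∞ ρ := φ.contDiff_normed
  have hρc : HasCompactSupport ρ := φ.hasCompactSupport_normed
  have hd := hρc.hasFDerivAt_convolution_left (μ := volume) (ContinuousLinearMap.lsmul ℝ ℝ)
    (hρs.of_le (mod_cast le_top)) hw z
  have hfd : fderiv ℝ (mollify φ (Ω.indicator w)) z = _ := hd.fderiv
  rw [hfd]
  ext h
  have hex1 := (hρc.fderiv ℝ).convolutionExists_left (μ := volume)
    ((ContinuousLinearMap.lsmul ℝ ℝ).precompL ℂ) (hρs.continuous_fderiv (by simp)) hw z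
  have hex2 := hρc.convolutionExists_left (μ := volume) (ContinuousLinearMap.lsmul ℝ ℝ)
    hρs.continuous hG' z
  have hex2' : Integrable fun t => ρ t • Ω.indicator G (z - t) := hex2
  rw [convolution_def, mollify_apply, ContinuousLinearMap.integral_apply hex1,
    ContinuousLinearMap.integral_apply hex2']
  have e1 := integral_sub_left_eq_self (μ := volume)
    (fun t => (fderiv ℝ ρ t h) • Ω.indicator w (z - t)) z
  have e2 := integral_sub_left_eq_self (μ := volume)
    (fun t => ρ t • (Ω.indicator G (z - t)) h) z
  simp only [sub_sub_cancel] at e1 e2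
  have htest : IsTestFunction Ω fun s => ρ (z - s) := by
    have hsupp : tsupport (fun s => ρ (z - s)) ⊆ Metric.closedBall z φ.rOut := by
      refine closure_minimal (fun s hs => ?_) Metric.isClosed_closedBall
      have : z - s ∈ Metric.ball (0 : ℂ) φ.rOut := by
        rw [← φ.support_normed_eq (μ := volume)]
        exact hs
      rw [Metric.mem_closedBall, dist_comm, dist_eq_norm]
      exact (mem_ball_zero_iff.1 this).le
    exact ⟨hρs.comp (contDiff_const.sub contDiff_id),
      HasCompactSupport.of_support_subset_isCompact (isCompact_closedBall z φ.rOut)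
        (subset_closure.trans hsupp), hsupp.trans hz⟩
  have hder : ∀ s, fderiv ℝ (fun s => ρ (z - s)) s h = -(fderiv ℝ ρ (z - s) h) := by
    intro s
    have h1 : HasFDerivAt (fun s : ℂ => z - s) (-ContinuousLinearMap.id ℝ ℂ) s :=
      (hasFDerivAt_id s).const_sub z
    have h2 := ((hρs.differentiable (by simp) (z - s)).hasFDerivAt).comp s h1
    rw [show (fun s => ρ (z - s)) = ρ ∘ fun s => z - s from rfl, h2.fderiv]
    simp
  have hweak := hG.2.2 _ htest h
  simp only [hder, neg_smul, integral_neg, neg_inj] at hweak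
  have i1 : ∫ s, (fderiv ℝ ρ (z - s) h) • Ω.indicator w s =
      ∫ s in Ω, (fderiv ℝ ρ (z - s) h) • w s := by
    rw [← integral_indicator hΩ.measurableSet]
    refine integral_congr_ae (ae_of_all _ fun s => ?_)
    by_cases hs : s ∈ Ω <;> simp [hs]
  have i2 : ∫ s, ρ (z - s) • (Ω.indicator G s) h = ∫ s in Ω, ρ (z - s) • G s h := by
    rw [← integral_indicator hΩ.measurableSet]
    refine integral_congr_ae (ae_of_all _ fun s => ?_)
    by_cases hs : s ∈ Ω <;> simp [hs]
  calc _ = ∫ t, (fderiv ℝ ρ t h) • Ω.indicator w (z - t) := rfl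
    _ = ∫ t, ρ t • (Ω.indicator G (z - t)) h := by rw [← e1, ← e2, i1, i2, hweak]
    _ = _ := rfl

/-- A sequence of mollifiers with radii tending to zero, so small that the balls around points of
the compact set `S` stay in `Ω`. -/
lemma exists_bump_seq (hΩ : IsOpen Ω) {S : Set ℂ} (hS : IsCompact S) (hSΩ : S ⊆ Ω) :
    ∃ φ : ℕ → ContDiffBump (0 : ℂ), Tendsto (fun n => (φ n).rOut) atTop (𝓝 0) ∧
      (∀ n, (φ n).rOut ≤ 1) ∧ ∀ n, ∀ z ∈ S, Metric.closedBall z (φ n).rOut ⊆ Ω := by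
  obtain ⟨δ, hδ, hδΩ⟩ := hS.exists_cthickening_subset_open hΩ hSΩ
  have hr : ∀ n : ℕ, 0 < min δ 1 / (n + 1) := fun n => by positivity
  let φ : ℕ → ContDiffBump (0 : ℂ) := fun n =>
    ⟨min δ 1 / (n + 1) / 2, min δ 1 / (n + 1), half_pos (hr n), half_lt_self (hr n)⟩
  have hrle : ∀ n : ℕ, min δ 1 / (n + 1) ≤ min δ 1 := fun n =>
    div_le_self (by positivity) (by linarith [n.cast_nonneg (α := ℝ)])
  have hφ0 : Tendsto (fun n => (φ n).rOut) atTop (𝓝 0) :=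
    tendsto_const_div_atTop_nhds_zero_nat (min δ 1) |>.comp (tendsto_add_atTop_nat 1)
      |>.congr fun n => by simp [φ]
  have hφ1 : ∀ n, (φ n).rOut ≤ 1 := fun n => (hrle n).trans (min_le_right _ _)
  have hball : ∀ n, ∀ z ∈ S, Metric.closedBall z (φ n).rOut ⊆ Ω := fun n z hz =>
    (Metric.closedBall_subset_closedBall ((hrle n).trans (min_le_left _ _))).trans
      ((Metric.closedBall_subset_cthickening hz δ).trans hδΩ)
  exact ⟨φ, hφ0, hφ1, hball⟩

/-- The product of a test function and a bounded Sobolev function is the limit in `W^{1,p}` of a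
bounded sequence of test functions, namely its products with mollifications. -/
lemma IsSobolev.exists_bounded_approx_smul [CompleteSpace F] (hΩ : IsOpen Ω) {p : ℝ} (hp : 1 ≤ p)
    {w : ℂ → F} {G : ℂ → ℂ →L[ℝ] F} (hw : IsSobolev Ω p w G) {M : ℝ} (hM : ∀ z, ‖w z‖ ≤ M)
    {χ : ℂ → ℝ} (hχ : IsTestFunction Ω χ) :
    ∃ (ψ : ℕ → ℂ → F) (K : ℝ),
      (∀ n, IsTestFunction Ω (ψ n)) ∧ (∀ n z, ‖ψ n z‖ ≤ K) ∧
      Tendsto (fun n => eLpNorm (fun z => ψ n z - χ z • w z) (ENNReal.ofReal p)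
        (volume.restrict Ω)) atTop (𝓝 0) ∧
      Tendsto (fun n => eLpNorm (fun z => fderiv ℝ (ψ n) z -
        (χ z • G z + (fderiv ℝ χ z).smulRight (w z))) (ENNReal.ofReal p)
        (volume.restrict Ω)) atTop (𝓝 0) := by
  have hp1 : 1 ≤ ENNReal.ofReal p := by simpa using ENNReal.ofReal_le_ofReal hp
  have hp0 : ENNReal.ofReal p ≠ 0 := (zero_lt_one.trans_le hp1).ne'
  have hpt : ENNReal.ofReal p ≠ ⊤ := ENNReal.ofReal_ne_top
  have hwL : MemLp (Ω.indicator w) (ENNReal.ofReal p) volume :=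
    memLp_indicator hΩ.measurableSet hw.2.1
  have hGL : MemLp (Ω.indicator G) (ENNReal.ofReal p) volume :=
    memLp_indicator hΩ.measurableSet hw.2.2
  have hwM : ∀ z, ‖Ω.indicator w z‖ ≤ M := fun z =>
    (norm_indicator_le_norm_self _ _).trans (hM z)
  obtain ⟨φ, hφ0, hφ1, hball⟩ := exists_bump_seq hΩ hχ.2.1.isCompact hχ.2.2
  have hwl : LocallyIntegrable (Ω.indicator w) := hwL.locallyIntegrable hp1
  have hGl : LocallyIntegrable (Ω.indicator G) := hGL.locallyIntegrable hp1
  let W : ℕ → ℂ → F := fun n => mollify (φ n) (Ω.indicator w)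
  have hWs : ∀ n, ContDiff ℝ ∞ (W n) := fun n => contDiff_mollify (φ n) hwl
  have hGs : ∀ n, ContDiff ℝ ∞ (mollify (φ n) (Ω.indicator G)) := fun n =>
    contDiff_mollify (φ n) hGl
  have hWM : ∀ n z, ‖W n z‖ ≤ M + M + M := fun n z => by
    have h1 := norm_mollify_sub_le (φ n) hwL.1 hwM z
    have h2 := norm_le_norm_add_norm_sub' (W n z) (Ω.indicator w z)
    linarith [hwM z]
  obtain ⟨K, hK⟩ := hχ.exists_bound
  obtain ⟨K', hK'⟩ := hχ.exists_fderiv_bound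
  have hK0 : 0 ≤ K := (norm_nonneg _).trans (hK 0)
  have hχm : AEStronglyMeasurable χ (volume.restrict Ω) := hχ.1.continuous.aestronglyMeasurable
  have hχm' : AEStronglyMeasurable (fderiv ℝ χ) (volume.restrict Ω) :=
    (hχ.1.continuous_fderiv (by simp)).aestronglyMeasurable
  have hWlim : Tendsto (fun n => eLpNorm (fun z => W n z - w z) (ENNReal.ofReal p)
      (volume.restrict Ω)) atTop (𝓝 0) := by
    refine tendsto_of_tendsto_of_tendsto_of_le_of_le tendsto_const_nhds
      (tendsto_eLpNorm_mollify_sub hp1 hpt hφ0 hφ1 hwL) (fun _ => zero_le) fun n => ?_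
    refine (le_of_eq (eLpNorm_congr_ae ?_)).trans (eLpNorm_restrict_le Ω _)
    filter_upwards [ae_restrict_mem hΩ.measurableSet] with z hz
    rw [indicator_of_mem hz]
  have hGlim : Tendsto (fun n => eLpNorm (fun z => mollify (φ n) (Ω.indicator G) z - G z)
      (ENNReal.ofReal p) (volume.restrict Ω)) atTop (𝓝 0) := by
    refine tendsto_of_tendsto_of_tendsto_of_le_of_le tendsto_const_nhds
      (tendsto_eLpNorm_mollify_sub hp1 hpt hφ0 hφ1 hGL) (fun _ => zero_le) fun n => ?_
    refine (le_of_eq (eLpNorm_congr_ae ?_)).trans (eLpNorm_restrict_le Ω _)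
    filter_upwards [ae_restrict_mem hΩ.measurableSet] with z hz
    rw [indicator_of_mem hz]
  have hder : ∀ n z, fderiv ℝ (fun z => χ z • W n z) z =
      χ z • mollify (φ n) (Ω.indicator G) z + (fderiv ℝ χ z).smulRight (W n z) := by
    intro n z
    have h := fderiv_smul (𝕜 := ℝ) (hχ.1.differentiable (by simp) z)
      ((hWs n).differentiable (by simp) z)
    rw [show (fun z => χ z • W n z) = χ • W n from rfl, h]
    congr 1
    by_cases hz : z ∈ tsupport χ
    · rw [fderiv_mollify_indicator hΩ hw.1 hwl hGl (φ n) (hball n z hz)]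
    · rw [image_eq_zero_of_notMem_tsupport hz, zero_smul, zero_smul]
  refine ⟨fun n z => χ z • W n z, K * (M + M + M), fun n => ⟨hχ.1.smul (hWs n), ?_, ?_⟩, ?_, ?_, ?_⟩
  · exact hχ.2.1.smul_right
  · exact (tsupport_smul_subset_left _ _).trans hχ.2.2
  · intro n z
    rw [norm_smul]
    exact mul_le_mul (hK z) (hWM n z) (norm_nonneg _) hK0
  · exact tendsto_eLpNorm_bilinear hp1 hpt hp0 (ContinuousLinearMap.lsmul ℝ ℝ)
      (m := fun _ => χ) (m' := χ) (K := K) (fun _ => hχm) hχm (fun _ => ae_of_all _ hK)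
      (ae_of_all _ hK) (fun n => (hWs n).continuous.aestronglyMeasurable) hw.2.1
      (tendsto_eLpNorm_sub_self _) hWlim
  · simp only [hder]
    have l1 := tendsto_eLpNorm_bilinear hp1 hpt hp0
      (ContinuousLinearMap.lsmul ℝ ℝ : ℝ →L[ℝ] (ℂ →L[ℝ] F) →L[ℝ] (ℂ →L[ℝ] F))
      (m := fun _ => χ) (m' := χ) (K := K) (fun _ => hχm) hχm (fun _ => ae_of_all _ hK)
      (ae_of_all _ hK) (fun n => (hGs n).continuous.aestronglyMeasurable) hw.2.2
      (tendsto_eLpNorm_sub_self _) hGlim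
    have l2 := tendsto_eLpNorm_bilinear hp1 hpt hp0 (ContinuousLinearMap.smulRightL ℝ ℂ F)
      (m := fun _ => fderiv ℝ χ) (m' := fderiv ℝ χ) (K := K') (fun _ => hχm') hχm'
      (fun _ => ae_of_all _ hK') (ae_of_all _ hK')
      (fun n => (hWs n).continuous.aestronglyMeasurable) hw.2.1
      (tendsto_eLpNorm_sub_self _) hWlim
    exact tendsto_eLpNorm_add hp1
      (fun n => hχm.smul (hGs n).continuous.aestronglyMeasurable) (hχm.smul hw.2.2.1)
      (fun n => (ContinuousLinearMap.smulRightL ℝ ℂ F).aestronglyMeasurable_comp₂ hχm'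
        (hWs n).continuous.aestronglyMeasurable)
      ((ContinuousLinearMap.smulRightL ℝ ℂ F).aestronglyMeasurable_comp₂ hχm' hw.2.1.1) l1 l2

/-- A function of `W^{1,p}_0` on a bounded set whose differential vanishes is zero. This is the
Poincaré inequality, used in `L^1`. -/
lemma IsSobolevZero.ae_eq_zero [FiniteDimensional ℝ F] (hb : Bornology.IsBounded Ω) {p : ℝ}
    (hp : 1 ≤ p) {η : ℂ → F} {G : ℂ → ℂ →L[ℝ] F} {θ : ℕ → ℂ → F} (hη : IsSobolev Ω p η G)
    (hθ : ∀ n, IsTestFunction Ω (θ n))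
    (hlim : Tendsto (fun n => eLpNorm (fun z => θ n z - η z) (ENNReal.ofReal p)
      (volume.restrict Ω)) atTop (𝓝 0))
    (hlim' : Tendsto (fun n => eLpNorm (fun z => fderiv ℝ (θ n) z - G z) (ENNReal.ofReal p)
      (volume.restrict Ω)) atTop (𝓝 0))
    (hG : ∀ᵐ z ∂(volume.restrict Ω), G z = 0) : ∀ᵐ z ∂(volume.restrict Ω), η z = 0 := by
  have hp1 : 1 ≤ ENNReal.ofReal p := by simpa using ENNReal.ofReal_le_ofReal hp
  have : IsFiniteMeasure (volume.restrict Ω) := ⟨by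
    rw [Measure.restrict_apply_univ]; exact hb.measure_lt_top⟩
  have hL1 : ∀ {F' : Type _} [NormedAddCommGroup F'] {f : ℕ → ℂ → F'},
      (∀ n, AEStronglyMeasurable (f n) (volume.restrict Ω)) →
      Tendsto (fun n => eLpNorm (f n) (ENNReal.ofReal p) (volume.restrict Ω)) atTop (𝓝 0) →
      Tendsto (fun n => eLpNorm (f n) 1 (volume.restrict Ω)) atTop (𝓝 0) := by
    intro F' _ f hf h
    refine tendsto_of_tendsto_of_tendsto_of_le_of_le tendsto_const_nhds ?_ (fun _ => zero_le)
      fun n => eLpNorm_le_eLpNorm_mul_rpow_measure_univ hp1 (hf n)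
    have hc : (volume.restrict Ω univ) ^
        (1 / (1 : ℝ≥0∞).toReal - 1 / (ENNReal.ofReal p).toReal) ≠ ⊤ := by
      refine ENNReal.rpow_ne_top_of_nonneg ?_ (measure_ne_top _ _)
      rw [ENNReal.toReal_ofReal (by linarith), ENNReal.toReal_one, one_div_one, sub_nonneg,
        div_le_one (by linarith)]
      exact hp
    simpa only [zero_mul] using ENNReal.Tendsto.mul_const h (Or.inr hc)
  have hθm : ∀ n, AEStronglyMeasurable (θ n) (volume.restrict Ω) := fun n =>
    (hθ n).1.continuous.aestronglyMeasurable
  have hgrad : Tendsto (fun n => eLpNorm (fderiv ℝ (θ n)) 1 (volume.restrict Ω))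
      atTop (𝓝 0) := by
    refine hL1 (fun n => ((hθ n).1.continuous_fderiv (by simp)).aestronglyMeasurable)
      (hlim'.congr fun n => eLpNorm_congr_ae ?_)
    filter_upwards [hG] with z hz
    rw [hz, sub_zero]
  have hpoinc : ∀ n, eLpNorm (θ n) 1 (volume.restrict Ω) ≤
      eLpNormLESNormFDerivOfLeConst F volume Ω 1 1 *
        eLpNorm (fderiv ℝ (θ n)) 1 (volume.restrict Ω) := by
    intro n
    have hsub : Function.support (θ n) ⊆ Ω := (subset_tsupport _).trans (hθ n).2.2
    have h := eLpNorm_le_eLpNorm_fderiv (μ := volume) ((hθ n).1.of_le (mod_cast le_top)) hsub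
      (p := 1) le_rfl (by simp) hb
    simp only [ENNReal.coe_one] at h
    have h2 : eLpNorm (fderiv ℝ (θ n)) 1 (volume.restrict Ω) = eLpNorm (fderiv ℝ (θ n)) 1 volume :=
      eLpNorm_restrict_eq ((support_fderiv_subset ℝ).trans (hθ n).2.2)
    have h3 : eLpNorm (θ n) 1 (volume.restrict Ω) ≤ eLpNorm (θ n) 1 volume :=
      eLpNorm_restrict_le Ω _
    rw [h2]
    exact h3.trans h
  have h0 : Tendsto (fun n => eLpNorm (θ n) 1 (volume.restrict Ω)) atTop (𝓝 0) := by
    refine tendsto_of_tendsto_of_tendsto_of_le_of_le tendsto_const_nhds ?_ (fun _ => zero_le) hpoinc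
    simpa only [mul_zero] using ENNReal.Tendsto.const_mul hgrad (Or.inr ENNReal.coe_ne_top)
  have h1 := hL1 (fun n => (hθm n).sub hη.2.1.1) hlim
  have h2 : eLpNorm η 1 (volume.restrict Ω) = 0 := by
    refine le_antisymm (ge_of_tendsto' (by simpa only [add_zero] using h0.add h1) fun n => ?_)
      zero_le
    have := eLpNorm_sub_le (hθm n) ((hθm n).sub hη.2.1.1) (le_refl (1 : ℝ≥0∞))
    rwa [sub_sub_cancel] at this
  rw [eLpNorm_eq_zero_iff hη.2.1.1 one_ne_zero] at h2
  exact h2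

end Approximation

/-! ### Enlarging the class of test fields of a weak equation -/

section WeakEquation

variable {E : Type*} [NormedAddCommGroup E] [InnerProductSpace ℝ E]
  {Ω : Set ℂ} {p : ℝ} {A : ℂ → (ℂ →L[ℝ] E) →L[ℝ] ℝ} {B : ℂ → E →L[ℝ] ℝ}

lemma MemLp.of_tendsto_sub {α F : Type*} [MeasurableSpace α] {μ : Measure α}
    [NormedAddCommGroup F] {p : ℝ≥0∞} {f : ℕ → α → F} {g : α → F}
    (hf : ∀ n, AEStronglyMeasurable (f n) μ) (hg : MemLp g p μ)
    (hlim : Tendsto (fun n => eLpNorm (fun x => f n x - g x) p μ) atTop (𝓝 0)) :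
    ∀ᶠ n in atTop, MemLp (f n) p μ := by
  filter_upwards [hlim.eventually (gt_mem_nhds ENNReal.zero_lt_top)] with n hn
  have h : MemLp (fun x => f n x - g x) p μ := ⟨(hf n).sub hg.1, hn⟩
  simpa using memLp_add h hg

/-- A functional in the dual space of `L^p` is continuous for convergence in `L^p`. -/
lemma tendsto_integral_apply {α F : Type*} [MeasurableSpace α] {μ : Measure α}
    [NormedAddCommGroup F] [NormedSpace ℝ F] {p q : ℝ≥0∞} [q.HolderTriple p 1]
    {L : α → F →L[ℝ] ℝ} (hL : MemLp L q μ) {f : ℕ → α → F} {g : α → F}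
    (hf : ∀ n, AEStronglyMeasurable (f n) μ) (hg : MemLp g p μ)
    (hlim : Tendsto (fun n => eLpNorm (fun x => f n x - g x) p μ) atTop (𝓝 0)) :
    Tendsto (fun n => ∫ x, L x (f n x) ∂μ) atTop (𝓝 (∫ x, L x (g x) ∂μ)) := by
  have hint : ∀ {h : α → F}, MemLp h p μ → Integrable (fun x => L x (h x)) μ := fun hh =>
    memLp_one_iff_integrable.1
      (ContinuousLinearMap.memLp_of_bilin 1 (ContinuousLinearMap.id ℝ (F →L[ℝ] ℝ)) hL hh)
  refine tendsto_integral_of_L1' (fun x => L x (g x)) (hint hg).1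
    ((MemLp.of_tendsto_sub hf hg hlim).mono fun n hn => hint hn) ?_
  refine tendsto_of_tendsto_of_tendsto_of_le_of_le tendsto_const_nhds
    (h := fun n => (1 : NNReal) * eLpNorm L q μ * eLpNorm (fun x => f n x - g x) p μ)
    ?_ (fun _ => zero_le) fun n => ?_
  · simpa only [mul_zero] using ENNReal.Tendsto.const_mul hlim
      (Or.inr (ENNReal.mul_ne_top ENNReal.coe_ne_top hL.eLpNorm_ne_top))
  · have h := eLpNorm_le_eLpNorm_mul_eLpNorm'_of_norm (p := q) (q := p) (r := 1) (μ := μ) hL.1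
      ((hf n).sub hg.1) (fun T v => T v) 1 (ae_of_all _ fun x => by
        simpa using (L x).le_opNorm ((f n - g) x))
    refine le_trans (le_of_eq ?_) h
    congr 1
    ext x
    simp

/-- A functional with density in `L^1` is continuous along uniformly bounded sequences that converge
in some `L^p`. -/
lemma tendsto_integral_apply_of_bounded {α F : Type*} [MeasurableSpace α] {μ : Measure α}
    [NormedAddCommGroup F] [NormedSpace ℝ F] {p : ℝ≥0∞} (hp0 : p ≠ 0)
    {L : α → F →L[ℝ] ℝ} (hL : MemLp L 1 μ) {f : ℕ → α → F} {g : α → F} {K : ℝ}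
    (hf : ∀ n, AEStronglyMeasurable (f n) μ) (hfK : ∀ n, ∀ᵐ x ∂μ, ‖f n x‖ ≤ K)
    (hg : AEStronglyMeasurable g μ) (hgK : ∀ᵐ x ∂μ, ‖g x‖ ≤ K)
    (hlim : Tendsto (fun n => eLpNorm (fun x => f n x - g x) p μ) atTop (𝓝 0)) :
    Tendsto (fun n => ∫ x, L x (f n x) ∂μ) atTop (𝓝 (∫ x, L x (g x) ∂μ)) := by
  have hint : ∀ {h : α → F}, AEStronglyMeasurable h μ → (∀ᵐ x ∂μ, ‖h x‖ ≤ K) →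
      Integrable (fun x => L x (h x)) μ := fun hh hhK => memLp_one_iff_integrable.1
    (MemLp.bilinear (ContinuousLinearMap.id ℝ (F →L[ℝ] ℝ)).flip hh hhK hL)
  exact tendsto_integral_of_L1' _ (hint hg hgK).1
    (Eventually.of_forall fun n => hint (hf n) (hfK n))
    (tendsto_eLpNorm_bilinear le_rfl ENNReal.one_ne_top hp0
      (ContinuousLinearMap.id ℝ (F →L[ℝ] ℝ)).flip hf hg hfK hgK (fun _ => hL.1) hL
      hlim (tendsto_eLpNorm_sub_self L))

/-- The weak equation `∫ A(H) = ∫ B(ψ)` over `Ω`, for the test field `ψ` with differential `H`. -/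
def WeakEq (Ω : Set ℂ) (A : ℂ → (ℂ →L[ℝ] E) →L[ℝ] ℝ) (B : ℂ → E →L[ℝ] ℝ) (ψ : ℂ → E)
    (H : ℂ → ℂ →L[ℝ] E) : Prop :=
  ∫ z in Ω, A z (H z) = ∫ z in Ω, B z (ψ z)

/-- A weak equation passes to limits in `W^{1,p}` of bounded test fields. The bound is needed
because the right hand side `B` is only in `L^1`. -/
lemma WeakEq.of_tendsto {p q : ℝ≥0∞} [q.HolderTriple p 1] (hp0 : p ≠ 0)
    (hA : MemLp A q (volume.restrict Ω)) (hB : MemLp B 1 (volume.restrict Ω))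
    {ψ : ℕ → ℂ → E} {H : ℕ → ℂ → ℂ →L[ℝ] E} {ψ' : ℂ → E} {H' : ℂ → ℂ →L[ℝ] E} {K : ℝ}
    (hψ : ∀ n, AEStronglyMeasurable (ψ n) (volume.restrict Ω))
    (hψK : ∀ n, ∀ᵐ z ∂(volume.restrict Ω), ‖ψ n z‖ ≤ K)
    (hψ' : AEStronglyMeasurable ψ' (volume.restrict Ω))
    (hψK' : ∀ᵐ z ∂(volume.restrict Ω), ‖ψ' z‖ ≤ K)
    (hH : ∀ n, AEStronglyMeasurable (H n) (volume.restrict Ω))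
    (hH' : MemLp H' p (volume.restrict Ω))
    (hψlim : Tendsto (fun n => eLpNorm (fun z => ψ n z - ψ' z) p (volume.restrict Ω))
      atTop (𝓝 0))
    (hHlim : Tendsto (fun n => eLpNorm (fun z => H n z - H' z) p (volume.restrict Ω))
      atTop (𝓝 0))
    (heq : ∀ n, WeakEq Ω A B (ψ n) (H n)) : WeakEq Ω A B ψ' H' := by
  have h1 := tendsto_integral_apply hA hH hH' hHlim
  have h2 := tendsto_integral_apply_of_bounded hp0 hB hψ hψK hψ' hψK' hψlim
  exact tendsto_nhds_unique h1 (h2.congr fun n => (heq n).symm)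

/-- The real inner product as a continuous bilinear map. -/
def innerL (E : Type*) [NormedAddCommGroup E] [InnerProductSpace ℝ E] : E →L[ℝ] E →L[ℝ] ℝ :=
  (innerₗ E).mkContinuous₂ 1 fun x y => by
    rw [one_mul]
    exact norm_inner_le_norm (𝕜 := ℝ) x y

lemma innerL_apply (x y : E) : innerL E x y = inner ℝ x y := rfl

lemma aestronglyMeasurable_fderiv {F : Type*} [NormedAddCommGroup F] [NormedSpace ℝ F]
    {φ : ℂ → F} (hφ : IsTestFunction Ω φ) :
    AEStronglyMeasurable (fderiv ℝ φ) (volume.restrict Ω) :=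
  (hφ.1.continuous_fderiv (by simp)).aestronglyMeasurable

/-- The differential of `|η|² w`, where `η` has differential `D` and `w` has differential `G`. -/
def normSqSmulDeriv (η w : E) (D G : ℂ →L[ℝ] E) : ℂ →L[ℝ] E :=
  ‖η‖ ^ 2 • G + ((2 : ℝ) • (innerL E η).comp D).smulRight w

lemma aestronglyMeasurable_normSqSmulDeriv {α : Type*} [MeasurableSpace α] {μ : Measure α}
    {η w : α → E} {D G : α → ℂ →L[ℝ] E} (hη : AEStronglyMeasurable η μ)
    (hw : AEStronglyMeasurable w μ) (hD : AEStronglyMeasurable D μ) (hG : AEStronglyMeasurable G μ) :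
    AEStronglyMeasurable (fun z => normSqSmulDeriv (η z) (w z) (D z) (G z)) μ := by
  refine ((hη.norm.pow 2).smul hG).add ?_
  refine (ContinuousLinearMap.smulRightL ℝ ℂ E).aestronglyMeasurable_comp₂ ?_ hw
  exact ((ContinuousLinearMap.compL ℝ ℂ E ℝ).aestronglyMeasurable_comp₂
    ((innerL E).continuous.comp_aestronglyMeasurable hη) hD).const_smul (2 : ℝ)

lemma isTestFunction_normSq {θ : ℂ → E} (hθ : IsTestFunction Ω θ) :
    IsTestFunction Ω fun z => ‖θ z‖ ^ 2 := by
  have h : ∀ z, θ z = 0 → ‖θ z‖ ^ 2 = 0 := fun z hz => by simp [hz]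
  have hs : Function.support (fun z => ‖θ z‖ ^ 2) ⊆ Function.support θ := fun z hz h0 => hz (h z h0)
  exact ⟨hθ.1.norm_sq ℝ, hθ.2.1.mono hs, (closure_mono hs).trans hθ.2.2⟩

lemma fderiv_normSq {θ : ℂ → E} (hθ : IsTestFunction Ω θ) (z : ℂ) :
    fderiv ℝ (fun z => ‖θ z‖ ^ 2) z = (2 : ℝ) • (innerL E (θ z)).comp (fderiv ℝ θ z) := by
  have h := ((hθ.1.differentiable (by simp) z).hasFDerivAt.norm_sq).fderiv
  rw [h]
  ext w
  simp [innerL_apply]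

/-- A weak equation valid for all test functions may be tested with bounded functions of
`W^{1,p}_0` and with products `|η|² w`, where `η ∈ W^{1,p}_0` and `w ∈ W^{1,p}` are bounded. -/
lemma weakEq_of_isSobolevZero [CompleteSpace E] (hΩ : IsOpen Ω) (hp : 1 ≤ p) {q : ℝ≥0∞}
    [q.HolderTriple (ENNReal.ofReal p) 1]
    (hA : MemLp A q (volume.restrict Ω)) (hB : MemLp B 1 (volume.restrict Ω))
    (heq : ∀ ψ : ℂ → E, IsTestFunction Ω ψ → WeakEq Ω A B ψ (fderiv ℝ ψ))
    {η : ℂ → E} {D : ℂ → ℂ →L[ℝ] E} {θ : ℕ → ℂ → E} {K : ℝ} (hη : IsSobolev Ω p η D)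
    (hθ : ∀ n, IsTestFunction Ω (θ n)) (hθK : ∀ n z, ‖θ n z‖ ≤ K)
    (hηK : ∀ᵐ z ∂(volume.restrict Ω), ‖η z‖ ≤ K)
    (hlim : Tendsto (fun n => eLpNorm (fun z => θ n z - η z) (ENNReal.ofReal p)
      (volume.restrict Ω)) atTop (𝓝 0))
    (hlim' : Tendsto (fun n => eLpNorm (fun z => fderiv ℝ (θ n) z - D z) (ENNReal.ofReal p)
      (volume.restrict Ω)) atTop (𝓝 0)) :
    WeakEq Ω A B η D ∧ ∀ (w : ℂ → E) (G : ℂ → ℂ →L[ℝ] E) (M : ℝ), IsSobolev Ω p w G →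
      (∀ z, ‖w z‖ ≤ M) →
      WeakEq Ω A B (fun z => ‖η z‖ ^ 2 • w z)
        (fun z => normSqSmulDeriv (η z) (w z) (D z) (G z)) := by
  have hp1 : 1 ≤ ENNReal.ofReal p := by simpa using ENNReal.ofReal_le_ofReal hp
  have hp0 : ENNReal.ofReal p ≠ 0 := (zero_lt_one.trans_le hp1).ne'
  have hpt : ENNReal.ofReal p ≠ ⊤ := ENNReal.ofReal_ne_top
  have hθm : ∀ n, AEStronglyMeasurable (θ n) (volume.restrict Ω) := fun n =>
    (hθ n).1.continuous.aestronglyMeasurable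
  have hK0 : 0 ≤ K := (norm_nonneg _).trans (hθK 0 0)
  refine ⟨WeakEq.of_tendsto hp0 hA hB hθm (fun n => ae_of_all _ (hθK n)) hη.2.1.1 hηK
    (fun n => aestronglyMeasurable_fderiv (hθ n)) hη.2.2 hlim hlim' fun n => heq _ (hθ n), ?_⟩
  intro w G M hw hM
  have hM0 : 0 ≤ M := (norm_nonneg _).trans (hM 0)
  have hsqK : ∀ {v : E}, ‖v‖ ≤ K → ‖‖v‖ ^ 2‖ ≤ K ^ 2 := fun hv => by
    rw [norm_pow, norm_norm]
    gcongr
  have hsmulK : ∀ {v u : E}, ‖v‖ ≤ K → ‖u‖ ≤ M → ‖‖v‖ ^ 2 • u‖ ≤ K ^ 2 * M := fun hv hu => by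
    rw [norm_smul]
    exact mul_le_mul (hsqK hv) hu (norm_nonneg _) (by positivity)
  -- the square of the norm of each approximation is an admissible smooth factor
  have hstep : ∀ n, WeakEq Ω A B (fun z => ‖θ n z‖ ^ 2 • w z)
      (fun z => normSqSmulDeriv (θ n z) (w z) (fderiv ℝ (θ n) z) (G z)) := by
    intro n
    have hχ := isTestFunction_normSq (hθ n)
    obtain ⟨ψ, K', hψ, hψK, hψlim, hψlim'⟩ := hw.exists_bounded_approx_smul hΩ hp hM hχ
    simp only [fderiv_normSq (hθ n)] at hψlim'
    have hH : MemLp (fun z => normSqSmulDeriv (θ n z) (w z) (fderiv ℝ (θ n) z) (G z))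
        (ENNReal.ofReal p) (volume.restrict Ω) := by
      have h1 := MemLp.bilinear (ContinuousLinearMap.lsmul ℝ ℝ : ℝ →L[ℝ] (ℂ →L[ℝ] E) →L[ℝ] _)
        hχ.1.continuous.aestronglyMeasurable
        (ae_of_all (volume.restrict Ω) fun z => hsqK (hθK n z)) hw.2.2
      obtain ⟨K₂, hK₂⟩ := hχ.exists_fderiv_bound
      have h2 := MemLp.bilinear (ContinuousLinearMap.smulRightL ℝ ℂ E)
        (aestronglyMeasurable_fderiv hχ) (ae_of_all (volume.restrict Ω) hK₂) hw.2.1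
      have h3 := memLp_add h1 h2
      simp only [fderiv_normSq (hθ n)] at h3
      exact h3
    refine WeakEq.of_tendsto (K := max K' (K ^ 2 * M)) hp0 hA hB
      (fun n => (hψ n).1.continuous.aestronglyMeasurable)
      (fun n => ae_of_all _ fun z => (hψK n z).trans (le_max_left _ _))
      (((hθm n).norm.pow 2).smul hw.2.1.1)
      (ae_of_all _ fun z => (hsmulK (hθK n z) (hM z)).trans (le_max_right _ _))
      (fun n => aestronglyMeasurable_fderiv (hψ n)) hH hψlim hψlim' fun n => heq _ (hψ n)
  have hsq : Tendsto (fun n => eLpNorm (fun z => ‖θ n z‖ ^ 2 - ‖η z‖ ^ 2) (ENNReal.ofReal p)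
      (volume.restrict Ω)) atTop (𝓝 0) := by
    have h := tendsto_eLpNorm_bilinear hp1 hpt hp0 (innerL E) hθm hη.2.1.1
      (fun n => ae_of_all _ (hθK n)) hηK hθm hη.2.1 hlim hlim
    simpa only [innerL_apply, real_inner_self_eq_norm_sq] using h
  have hsqm : ∀ n, AEStronglyMeasurable (fun z => ‖θ n z‖ ^ 2) (volume.restrict Ω) := fun n =>
    (hθm n).norm.pow 2
  have hsqm' : AEStronglyMeasurable (fun z => ‖η z‖ ^ 2) (volume.restrict Ω) := hη.2.1.1.norm.pow 2
  have hsqb : ∀ n, ∀ᵐ z ∂(volume.restrict Ω), ‖‖θ n z‖ ^ 2‖ ≤ K ^ 2 := fun n =>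
    ae_of_all _ fun z => hsqK (hθK n z)
  have hsqb' : ∀ᵐ z ∂(volume.restrict Ω), ‖‖η z‖ ^ 2‖ ≤ K ^ 2 := hηK.mono fun z hz => hsqK hz
  have hψlim := tendsto_eLpNorm_bilinear hp1 hpt hp0
    (ContinuousLinearMap.lsmul ℝ ℝ : ℝ →L[ℝ] E →L[ℝ] E) hsqm hsqm' hsqb hsqb'
    (fun _ => hw.2.1.1) hw.2.1 hsq (tendsto_eLpNorm_sub_self w)
  have l1 := tendsto_eLpNorm_bilinear hp1 hpt hp0
    (ContinuousLinearMap.lsmul ℝ ℝ : ℝ →L[ℝ] (ℂ →L[ℝ] E) →L[ℝ] (ℂ →L[ℝ] E)) hsqm hsqm' hsqb hsqb'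
    (fun _ => hw.2.2.1) hw.2.2 hsq (tendsto_eLpNorm_sub_self G)
  let Q : E →L[ℝ] (ℂ →L[ℝ] E) →L[ℝ] (ℂ →L[ℝ] ℝ) :=
    (2 : ℝ) • (ContinuousLinearMap.compL ℝ ℂ E ℝ).comp (innerL E)
  have hQ : ∀ v T, Q v T = (2 : ℝ) • (innerL E v).comp T := fun v T => rfl
  have l2 := tendsto_eLpNorm_bilinear hp1 hpt hp0 Q hθm hη.2.1.1
      (fun n => ae_of_all _ (hθK n)) hηK (fun n => aestronglyMeasurable_fderiv (hθ n)) hη.2.2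
      hlim hlim'
  have hQL : MemLp (fun z => Q (η z) (D z)) (ENNReal.ofReal p) (volume.restrict Ω) :=
    MemLp.bilinear Q hη.2.1.1 hηK hη.2.2
  have hQm : ∀ n, AEStronglyMeasurable (fun z => Q (θ n z) (fderiv ℝ (θ n) z))
      (volume.restrict Ω) := fun n =>
    Q.aestronglyMeasurable_comp₂ (hθm n) (aestronglyMeasurable_fderiv (hθ n))
  have l3 := tendsto_eLpNorm_bilinear hp1 hpt hp0 (ContinuousLinearMap.smulRightL ℝ ℂ E).flip
      (m := fun _ => w) (K := M) (fun _ => hw.2.1.1) hw.2.1.1 (fun _ => ae_of_all _ hM)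
      (ae_of_all _ hM) hQm hQL (tendsto_eLpNorm_sub_self w) l2
  have hH1 : MemLp (fun z => ‖η z‖ ^ 2 • G z) (ENNReal.ofReal p) (volume.restrict Ω) :=
    MemLp.bilinear (ContinuousLinearMap.lsmul ℝ ℝ : ℝ →L[ℝ] (ℂ →L[ℝ] E) →L[ℝ] _)
      hsqm' hsqb' hw.2.2
  have hH2 : MemLp (fun z => (Q (η z) (D z)).smulRight (w z)) (ENNReal.ofReal p)
      (volume.restrict Ω) :=
    MemLp.bilinear (ContinuousLinearMap.smulRightL ℝ ℂ E).flip hw.2.1.1 (ae_of_all _ hM) hQL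
  refine WeakEq.of_tendsto (K := K ^ 2 * M) hp0 hA hB (fun n => (hsqm n).smul hw.2.1.1)
    (fun n => ae_of_all _ fun z => hsmulK (hθK n z) (hM z)) (hsqm'.smul hw.2.1.1)
    (hηK.mono fun z hz => hsmulK hz (hM z))
    (fun n => aestronglyMeasurable_normSqSmulDeriv (hθm n) hw.2.1.1
      (aestronglyMeasurable_fderiv (hθ n)) hw.2.2.1) (memLp_add hH1 hH2) hψlim ?_ hstep
  exact tendsto_eLpNorm_add hp1 (fun n => (hsqm n).smul hw.2.2.1) hH1.1
    (fun n => (ContinuousLinearMap.smulRightL ℝ ℂ E).flip.aestronglyMeasurable_comp₂ hw.2.1.1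
      (hQm n)) hH2.1 l1 l3

end WeakEquation

/-! ### The energy inequalities -/

section Energy

variable {E : Type*} [NormedAddCommGroup E] [InnerProductSpace ℝ E]

/-- The Hilbert-Schmidt inner product of two linear maps `ℂ → E`. -/
def pairL (E : Type*) [NormedAddCommGroup E] [InnerProductSpace ℝ E] :
    (ℂ →L[ℝ] E) →L[ℝ] (ℂ →L[ℝ] E) →L[ℝ] ℝ :=
  (innerL E).bilinearComp (ContinuousLinearMap.apply ℝ E 1) (ContinuousLinearMap.apply ℝ E 1) +
    (innerL E).bilinearComp (ContinuousLinearMap.apply ℝ E Complex.I)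
      (ContinuousLinearMap.apply ℝ E Complex.I)

lemma pairL_apply (D D' : ℂ →L[ℝ] E) :
    pairL E D D' = inner ℝ (D 1) (D' 1) + inner ℝ (D Complex.I) (D' Complex.I) := rfl

/-- The square of the Hilbert-Schmidt norm of a linear map `ℂ → E`. -/
def hsSq (D : ℂ →L[ℝ] E) : ℝ := ‖D 1‖ ^ 2 + ‖D Complex.I‖ ^ 2

lemma hsSq_nonneg (D : ℂ →L[ℝ] E) : 0 ≤ hsSq D := by unfold hsSq; positivity

lemma pairL_self (D : ℂ →L[ℝ] E) : pairL E D D = hsSq D := by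
  rw [pairL_apply, real_inner_self_eq_norm_sq, real_inner_self_eq_norm_sq, hsSq]

lemma norm_apply_one_le (D : ℂ →L[ℝ] E) : ‖D 1‖ ≤ ‖D‖ := by
  simpa using D.le_opNorm 1

lemma norm_apply_I_le (D : ℂ →L[ℝ] E) : ‖D Complex.I‖ ≤ ‖D‖ := by
  simpa using D.le_opNorm Complex.I

lemma hsSq_le (D : ℂ →L[ℝ] E) {g : ℝ} (hg : ‖D‖ ≤ g) : hsSq D ≤ 2 * g ^ 2 := by
  have h1 := (norm_apply_one_le D).trans hg
  have hI := (norm_apply_I_le D).trans hg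
  have e1 := pow_le_pow_left₀ (norm_nonneg _) h1 2
  have e2 := pow_le_pow_left₀ (norm_nonneg _) hI 2
  unfold hsSq
  linarith

lemma abs_pairL_le (D D' : ℂ →L[ℝ] E) {g : ℝ} (hD : ‖D‖ ≤ g) (hD' : ‖D'‖ ≤ g) :
    |pairL E D D'| ≤ 2 * g ^ 2 := by
  have hg : 0 ≤ g := (norm_nonneg _).trans hD
  have h1 : |inner ℝ (D 1) (D' 1)| ≤ g * g := (abs_real_inner_le_norm _ _).trans
    (mul_le_mul ((norm_apply_one_le D).trans hD) ((norm_apply_one_le D').trans hD')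
      (norm_nonneg _) hg)
  have hI : |inner ℝ (D Complex.I) (D' Complex.I)| ≤ g * g := (abs_real_inner_le_norm _ _).trans
    (mul_le_mul ((norm_apply_I_le D).trans hD) ((norm_apply_I_le D').trans hD')
      (norm_nonneg _) hg)
  rw [pairL_apply]
  refine (abs_add_le _ _).trans ?_
  linarith

lemma eq_zero_of_hsSq_eq_zero {D : ℂ →L[ℝ] E} (h : hsSq D = 0) : D = 0 := by
  have h1 : D 1 = 0 := by
    have : ‖D 1‖ ^ 2 = 0 := by
      unfold hsSq at h; nlinarith [sq_nonneg ‖D 1‖, sq_nonneg ‖D Complex.I‖]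
    simpa using this
  have hI : D Complex.I = 0 := by
    have : ‖D Complex.I‖ ^ 2 = 0 := by
      unfold hsSq at h; nlinarith [sq_nonneg ‖D 1‖, sq_nonneg ‖D Complex.I‖]
    simpa using this
  ext w
  have hw : w = w.re • (1 : ℂ) + w.im • Complex.I := by simp [Complex.re_add_im]
  rw [hw, map_add, map_smul, map_smul, h1, hI]
  simp

/-- Monotonicity of `D ↦ l(D) D` when `l` is an increasing function of `|D|²`. -/
lemma half_mul_hsSq_sub_le {D₁ D₂ : ℂ →L[ℝ] E} {l₁ l₂ : ℝ}
    (h : 0 ≤ (l₁ - l₂) * (hsSq D₁ - hsSq D₂)) :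
    (l₁ + l₂) / 2 * hsSq (D₁ - D₂) ≤
      l₁ * pairL E D₁ (D₁ - D₂) - l₂ * pairL E D₂ (D₁ - D₂) := by
  have e1 := norm_sub_sq_real (D₁ 1) (D₂ 1)
  have eI := norm_sub_sq_real (D₁ Complex.I) (D₂ Complex.I)
  have c1 := real_inner_comm (D₁ 1) (D₂ 1)
  have cI := real_inner_comm (D₁ Complex.I) (D₂ Complex.I)
  simp only [hsSq, pairL_apply, sub_apply, inner_sub_right, real_inner_self_eq_norm_sq]
    at h ⊢
  rw [e1, eI, c1, cI]
  nlinarith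

/-- The part of `∇(|η|² w)` that contains `∇η` pairs with `∇v` to a term which Young's inequality
splits into a piece that can be absorbed and a multiple of `δ² |∇η|²`. -/
lemma abs_pairL_smulRight_le (G D : ℂ →L[ℝ] E) (η w : E) {δ : ℝ} (hw : ‖w‖ ≤ δ) :
    |pairL E G (((2 : ℝ) • (innerL E η).comp D).smulRight w)| ≤
      1 / 4 * (‖η‖ ^ 2 * hsSq G) + 4 * δ ^ 2 * hsSq D := by
  have key : ∀ X Y : E, |inner ℝ X ((2 * inner ℝ η Y) • w)| ≤
      1 / 4 * (‖η‖ ^ 2 * ‖X‖ ^ 2) + 4 * δ ^ 2 * ‖Y‖ ^ 2 := by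
    intro X Y
    have hδ : 0 ≤ δ := (norm_nonneg _).trans hw
    rw [inner_smul_right, abs_mul, abs_mul, abs_two]
    have h1 := abs_real_inner_le_norm η Y
    have h2 : |inner ℝ X w| ≤ ‖X‖ * δ := (abs_real_inner_le_norm X w).trans (by gcongr)
    have h3 : 2 * |inner ℝ η Y| * |inner ℝ X w| ≤ 2 * (‖η‖ * ‖Y‖) * (‖X‖ * δ) := by gcongr
    nlinarith [sq_nonneg (1 / 2 * (‖η‖ * ‖X‖) - 2 * (δ * ‖Y‖))]
  have e : ∀ x : ℂ, (((2 : ℝ) • (innerL E η).comp D).smulRight w) x =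
      (2 * inner ℝ η (D x)) • w := fun x => rfl
  rw [pairL_apply, e, e]
  refine (abs_add_le _ _).trans ?_
  have h1 := key (G 1) (D 1)
  have hI := key (G Complex.I) (D Complex.I)
  unfold hsSq
  linarith

variable {α : Type*} [MeasurableSpace α] {μ : Measure α}

lemma aestronglyMeasurable_hsSq {G : α → ℂ →L[ℝ] E} (hG : AEStronglyMeasurable G μ) :
    AEStronglyMeasurable (fun z => hsSq (G z)) μ :=
  ((hG.apply_continuousLinearMap 1).norm.pow 2).add
    ((hG.apply_continuousLinearMap Complex.I).norm.pow 2)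

/-- The Caccioppoli inequality. It comes from the test field `|η|² w`, where `w` is the solution
minus a constant and takes values in a small ball: since `‖b‖ ≤ C |G|²`, the curvature term and
part of the cross term are absorbed by the left hand side. -/
lemma caccioppoli {G D : α → ℂ →L[ℝ] E} {η w b : α → E} {l : α → ℝ} {C δ K : ℝ} {g : α → ℝ}
    (hG : AEStronglyMeasurable G μ) (hD : AEStronglyMeasurable D μ)
    (hη : AEStronglyMeasurable η μ) (hw : AEStronglyMeasurable w μ)
    (hb : AEStronglyMeasurable b μ) (hl : AEStronglyMeasurable l μ)
    (hint : Integrable (fun z => l z * g z ^ 2) μ)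
    (hl0 : ∀ᵐ z ∂μ, 0 < l z) (hGg : ∀ᵐ z ∂μ, ‖G z‖ ≤ g z) (hDg : ∀ᵐ z ∂μ, ‖D z‖ ≤ g z)
    (hηK : ∀ᵐ z ∂μ, ‖η z‖ ≤ K) (hC : 0 ≤ C) (hδ : C * δ ≤ 1 / 4)
    (hwδ : ∀ᵐ z ∂μ, ‖w z‖ ≤ δ) (hbC : ∀ᵐ z ∂μ, ‖b z‖ ≤ C * hsSq (G z))
    (heq : ∫ z, -(l z * pairL E (G z) (normSqSmulDeriv (η z) (w z) (D z) (G z))) ∂μ =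
      ∫ z, l z * inner ℝ (b z) (‖η z‖ ^ 2 • w z) ∂μ) :
    ∫ z, l z * (hsSq (G z) * ‖η z‖ ^ 2) ∂μ ≤ 8 * δ ^ 2 * ∫ z, l z * hsSq (D z) ∂μ := by
  have hI : ∀ {f : α → ℝ} (c : ℝ), AEStronglyMeasurable f μ →
      (∀ᵐ z ∂μ, |f z| ≤ c * g z ^ 2) → Integrable (fun z => l z * f z) μ := by
    intro f c hf hle
    refine (hint.const_mul c).mono' (hl.mul hf) ?_
    filter_upwards [hle, hl0] with z h1 h2
    rw [Real.norm_eq_abs, abs_mul, abs_of_pos h2]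
    nlinarith
  have hGm := aestronglyMeasurable_hsSq hG
  have hDm := aestronglyMeasurable_hsSq hD
  have hX : Integrable (fun z => l z * (hsSq (G z) * ‖η z‖ ^ 2)) μ := by
    refine hI (2 * K ^ 2) (hGm.mul (hη.norm.pow 2)) ?_
    filter_upwards [hGg, hηK] with z h1 h2
    rw [abs_of_nonneg (mul_nonneg (hsSq_nonneg _) (sq_nonneg _))]
    calc hsSq (G z) * ‖η z‖ ^ 2 ≤ (2 * g z ^ 2) * K ^ 2 := by gcongr; exact hsSq_le _ h1
      _ = _ := by ring
  have hY : Integrable (fun z => l z * hsSq (D z)) μ := by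
    refine hI 2 hDm ?_
    filter_upwards [hDg] with z h1
    rw [abs_of_nonneg (hsSq_nonneg _)]
    exact hsSq_le _ h1
  have hpt : ∀ᵐ z ∂μ, |pairL E (G z) (normSqSmulDeriv (η z) (w z) (D z) (G z)) -
      ‖η z‖ ^ 2 * hsSq (G z)| ≤ 1 / 4 * (‖η z‖ ^ 2 * hsSq (G z)) + 4 * δ ^ 2 * hsSq (D z) := by
    filter_upwards [hwδ] with z h1
    have h2 := abs_pairL_smulRight_le (G z) (D z) (η z) (w z) h1
    rw [normSqSmulDeriv, map_add, map_smul, pairL_self, smul_eq_mul, add_sub_cancel_left]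
    exact h2
  have hHm : AEStronglyMeasurable
      (fun z => pairL E (G z) (normSqSmulDeriv (η z) (w z) (D z) (G z))) μ :=
    (pairL E).aestronglyMeasurable_comp₂ hG
      (aestronglyMeasurable_normSqSmulDeriv hη hw hD hG)
  have hA : Integrable (fun z =>
      l z * pairL E (G z) (normSqSmulDeriv (η z) (w z) (D z) (G z))) μ := by
    refine hI (5 / 4 * (2 * K ^ 2) + 4 * δ ^ 2 * 2) hHm ?_
    filter_upwards [hpt, hGg, hDg, hηK] with z h1 h2 h3 h4
    have e1 : ‖η z‖ ^ 2 * hsSq (G z) ≤ K ^ 2 * (2 * g z ^ 2) :=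
      mul_le_mul (pow_le_pow_left₀ (norm_nonneg _) h4 2) (hsSq_le _ h2) (hsSq_nonneg _)
        (sq_nonneg _)
    have e2 : 4 * δ ^ 2 * hsSq (D z) ≤ 4 * δ ^ 2 * (2 * g z ^ 2) := by
      gcongr
      exact hsSq_le _ h3
    have e0 : 0 ≤ ‖η z‖ ^ 2 * hsSq (G z) := mul_nonneg (sq_nonneg _) (hsSq_nonneg _)
    rw [abs_le] at h1 ⊢
    constructor <;> linarith [h1.1, h1.2]
  have hptB : ∀ᵐ z ∂μ, |inner ℝ (b z) (‖η z‖ ^ 2 • w z)| ≤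
      1 / 4 * (hsSq (G z) * ‖η z‖ ^ 2) := by
    filter_upwards [hwδ, hbC] with z h1 h2
    rw [inner_smul_right, abs_mul, abs_of_nonneg (sq_nonneg ‖η z‖)]
    have h3 : |inner ℝ (b z) (w z)| ≤ C * hsSq (G z) * δ := (abs_real_inner_le_norm _ _).trans
      (mul_le_mul h2 h1 (norm_nonneg _) (mul_nonneg hC (hsSq_nonneg _)))
    have h4 : C * hsSq (G z) * δ ≤ 1 / 4 * hsSq (G z) := by
      nlinarith [hsSq_nonneg (G z)]
    nlinarith [sq_nonneg ‖η z‖]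
  have hB : Integrable (fun z => l z * inner ℝ (b z) (‖η z‖ ^ 2 • w z)) μ := by
    refine hI (1 / 4 * (2 * K ^ 2)) (hb.inner ((hη.norm.pow 2).smul hw)) ?_
    filter_upwards [hptB, hGg, hηK] with z h1 h2 h4
    have e1 : hsSq (G z) * ‖η z‖ ^ 2 ≤ (2 * g z ^ 2) * K ^ 2 :=
      mul_le_mul (hsSq_le _ h2) (pow_le_pow_left₀ (norm_nonneg _) h4 2) (sq_nonneg _)
        (by positivity)
    linarith
  have up : ∫ z, -(l z * pairL E (G z) (normSqSmulDeriv (η z) (w z) (D z) (G z))) ∂μ ≤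
      ∫ z, (-(3 / 4) * (l z * (hsSq (G z) * ‖η z‖ ^ 2)) + 4 * δ ^ 2 * (l z * hsSq (D z))) ∂μ := by
    refine integral_mono_ae hA.neg ((hX.const_mul _).add (hY.const_mul _)) ?_
    filter_upwards [hpt, hl0] with z h1 h2
    have := (abs_le.1 h1).1
    nlinarith
  have low : ∫ z, -(1 / 4) * (l z * (hsSq (G z) * ‖η z‖ ^ 2)) ∂μ ≤
      ∫ z, l z * inner ℝ (b z) (‖η z‖ ^ 2 • w z) ∂μ := by
    refine integral_mono_ae (hX.const_mul _) hB ?_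
    filter_upwards [hptB, hl0] with z h1 h2
    have := (abs_le.1 h1).1
    nlinarith
  rw [integral_add (hX.const_mul _) (hY.const_mul _), integral_const_mul, integral_const_mul] at up
  rw [integral_const_mul] at low
  linarith

/-- The heart of the uniqueness theorem: subtract the two equations tested with `η = v₁ - v₂`, use
monotonicity on the left and, on the right, the quadratic bound for the curvature terms together
with the Caccioppoli inequalities `hcac₁`, `hcac₂`. For small `δ` only `D = 0` is possible. -/
lemma ae_eq_zero_of_energy {G₁ G₂ D : α → ℂ →L[ℝ] E} {η b₁ b₂ : α → E} {l₁ l₂ : α → ℝ}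
    {C δ K : ℝ} {g : α → ℝ}
    (hG₁ : AEStronglyMeasurable G₁ μ) (hG₂ : AEStronglyMeasurable G₂ μ)
    (hDm : AEStronglyMeasurable D μ) (hη : AEStronglyMeasurable η μ)
    (hb₁ : AEStronglyMeasurable b₁ μ) (hb₂ : AEStronglyMeasurable b₂ μ)
    (hl₁ : AEStronglyMeasurable l₁ μ) (hl₂ : AEStronglyMeasurable l₂ μ)
    (hint₁ : Integrable (fun z => l₁ z * g z ^ 2) μ)
    (hint₂ : Integrable (fun z => l₂ z * g z ^ 2) μ)
    (hpos₁ : ∀ᵐ z ∂μ, 0 < l₁ z) (hpos₂ : ∀ᵐ z ∂μ, 0 < l₂ z)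
    (hg₁ : ∀ᵐ z ∂μ, ‖G₁ z‖ ≤ g z) (hg₂ : ∀ᵐ z ∂μ, ‖G₂ z‖ ≤ g z) (hgD : ∀ᵐ z ∂μ, ‖D z‖ ≤ g z)
    (hηK : ∀ᵐ z ∂μ, ‖η z‖ ≤ K) (hC : 0 ≤ C) (hδ : C * δ ^ 2 ≤ 1 / 32)
    (hD : ∀ᵐ z ∂μ, D z = G₁ z - G₂ z)
    (hmono : ∀ᵐ z ∂μ, 0 ≤ (l₁ z - l₂ z) * (hsSq (G₁ z) - hsSq (G₂ z)))
    (hbη₁ : ∀ᵐ z ∂μ, |inner ℝ (b₁ z) (η z)| ≤ C * (hsSq (G₁ z) * ‖η z‖ ^ 2))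
    (hbη₂ : ∀ᵐ z ∂μ, |inner ℝ (b₂ z) (η z)| ≤ C * (hsSq (G₂ z) * ‖η z‖ ^ 2))
    (heq₁ : ∫ z, -(l₁ z * pairL E (G₁ z) (D z)) ∂μ = ∫ z, l₁ z * inner ℝ (b₁ z) (η z) ∂μ)
    (heq₂ : ∫ z, -(l₂ z * pairL E (G₂ z) (D z)) ∂μ = ∫ z, l₂ z * inner ℝ (b₂ z) (η z) ∂μ)
    (hcac₁ : ∫ z, l₁ z * (hsSq (G₁ z) * ‖η z‖ ^ 2) ∂μ ≤ 8 * δ ^ 2 * ∫ z, l₁ z * hsSq (D z) ∂μ)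
    (hcac₂ : ∫ z, l₂ z * (hsSq (G₂ z) * ‖η z‖ ^ 2) ∂μ ≤ 8 * δ ^ 2 * ∫ z, l₂ z * hsSq (D z) ∂μ) :
    ∀ᵐ z ∂μ, D z = 0 := by
  have hI : ∀ {l f : α → ℝ} (c : ℝ), AEStronglyMeasurable l μ → (∀ᵐ z ∂μ, 0 < l z) →
      Integrable (fun z => l z * g z ^ 2) μ → AEStronglyMeasurable f μ →
      (∀ᵐ z ∂μ, |f z| ≤ c * g z ^ 2) → Integrable (fun z => l z * f z) μ := by
    intro l f c hl hl0 hint hf hle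
    refine (hint.const_mul c).mono' (hl.mul hf) ?_
    filter_upwards [hle, hl0] with z h1 h2
    rw [Real.norm_eq_abs, abs_mul, abs_of_pos h2]
    nlinarith
  -- the quantities occurring in the estimate are integrable, for either solution
  have hall : ∀ {l : α → ℝ} {G : α → ℂ →L[ℝ] E} {b : α → E}, AEStronglyMeasurable l μ →
      (∀ᵐ z ∂μ, 0 < l z) → Integrable (fun z => l z * g z ^ 2) μ → AEStronglyMeasurable G μ →
      (∀ᵐ z ∂μ, ‖G z‖ ≤ g z) → AEStronglyMeasurable b μ →
      (∀ᵐ z ∂μ, |inner ℝ (b z) (η z)| ≤ C * (hsSq (G z) * ‖η z‖ ^ 2)) →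
      Integrable (fun z => l z * (hsSq (G z) * ‖η z‖ ^ 2)) μ ∧
      Integrable (fun z => l z * hsSq (D z)) μ ∧
      Integrable (fun z => l z * pairL E (G z) (D z)) μ ∧
      Integrable (fun z => l z * inner ℝ (b z) (η z)) μ := by
    intro l G b hl hl0 hint hG hGg hb hbη
    have hX : ∀ᵐ z ∂μ, hsSq (G z) * ‖η z‖ ^ 2 ≤ 2 * K ^ 2 * g z ^ 2 := by
      filter_upwards [hGg, hηK] with z h1 h2
      calc hsSq (G z) * ‖η z‖ ^ 2 ≤ (2 * g z ^ 2) * K ^ 2 := by gcongr; exact hsSq_le _ h1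
        _ = _ := by ring
    refine ⟨hI (2 * K ^ 2) hl hl0 hint ((aestronglyMeasurable_hsSq hG).mul (hη.norm.pow 2)) ?_,
      hI 2 hl hl0 hint (aestronglyMeasurable_hsSq hDm) ?_,
      hI 2 hl hl0 hint ((pairL E).aestronglyMeasurable_comp₂ hG hDm) ?_,
      hI (C * (2 * K ^ 2)) hl hl0 hint (hb.inner hη) ?_⟩
    · filter_upwards [hX] with z h1
      rwa [abs_of_nonneg (mul_nonneg (hsSq_nonneg _) (sq_nonneg _))]
    · filter_upwards [hgD] with z h1
      rw [abs_of_nonneg (hsSq_nonneg _)]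
      exact hsSq_le _ h1
    · filter_upwards [hGg, hgD] with z h1 h2 using abs_pairL_le _ _ h1 h2
    · filter_upwards [hX, hbη] with z h1 h2
      refine h2.trans ?_
      rw [mul_assoc]
      gcongr
  obtain ⟨X₁, Y₁, A₁, B₁⟩ := hall hl₁ hpos₁ hint₁ hG₁ hg₁ hb₁ hbη₁
  obtain ⟨X₂, Y₂, A₂, B₂⟩ := hall hl₂ hpos₂ hint₂ hG₂ hg₂ hb₂ hbη₂
  rw [integral_neg] at heq₁ heq₂
  have hleft : ∫ z, (1 / 2 * (l₁ z * hsSq (D z)) + 1 / 2 * (l₂ z * hsSq (D z))) ∂μ ≤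
      ∫ z, (l₁ z * pairL E (G₁ z) (D z) - l₂ z * pairL E (G₂ z) (D z)) ∂μ := by
    refine integral_mono_ae ((Y₁.const_mul _).add (Y₂.const_mul _)) (A₁.sub A₂) ?_
    filter_upwards [hD, hmono] with z h1 h2
    have := half_mul_hsSq_sub_le h2
    rw [← h1] at this
    linarith
  have hright : ∀ {l : α → ℝ} {G : α → ℂ →L[ℝ] E} {b : α → E}, (∀ᵐ z ∂μ, 0 < l z) →
      (∀ᵐ z ∂μ, |inner ℝ (b z) (η z)| ≤ C * (hsSq (G z) * ‖η z‖ ^ 2)) →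
      Integrable (fun z => l z * (hsSq (G z) * ‖η z‖ ^ 2)) μ →
      Integrable (fun z => l z * inner ℝ (b z) (η z)) μ →
      |∫ z, l z * inner ℝ (b z) (η z) ∂μ| ≤ C * ∫ z, l z * (hsSq (G z) * ‖η z‖ ^ 2) ∂μ := by
    intro l G b hl0 hbη hX hB
    rw [← integral_const_mul]
    refine (abs_integral_le_integral_abs).trans (integral_mono_ae hB.abs (hX.const_mul C) ?_)
    filter_upwards [hbη, hl0] with z h1 h2
    simp only [abs_mul, abs_of_pos h2]
    nlinarith
  have R₁ := hright hpos₁ hbη₁ X₁ B₁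
  have R₂ := hright hpos₂ hbη₂ X₂ B₂
  rw [integral_add (Y₁.const_mul _) (Y₂.const_mul _), integral_const_mul, integral_const_mul,
    integral_sub A₁ A₂] at hleft
  have n₁ : 0 ≤ ∫ z, l₁ z * hsSq (D z) ∂μ := integral_nonneg_of_ae (hpos₁.mono fun z hz =>
    mul_nonneg hz.le (hsSq_nonneg _))
  have n₂ : 0 ≤ ∫ z, l₂ z * hsSq (D z) ∂μ := integral_nonneg_of_ae (hpos₂.mono fun z hz =>
    mul_nonneg hz.le (hsSq_nonneg _))
  have C₁ := mul_le_mul_of_nonneg_left hcac₁ hC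
  have C₂ := mul_le_mul_of_nonneg_left hcac₂ hC
  have S₁ := mul_le_mul_of_nonneg_right hδ n₁
  have S₂ := mul_le_mul_of_nonneg_right hδ n₂
  have hzero : ∫ z, l₁ z * hsSq (D z) ∂μ = 0 := by
    linarith [(abs_le.1 R₁).1, (abs_le.1 R₂).2]
  have := (integral_eq_zero_iff_of_nonneg_ae (hpos₁.mono fun z hz =>
    mul_nonneg hz.le (hsSq_nonneg _)) Y₁).1 hzero
  filter_upwards [this, hpos₁] with z h1 h2
  exact eq_zero_of_hsSq_eq_zero ((mul_eq_zero.1 h1).resolve_left h2.ne')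

end Energy

/-! ### Differences of Sobolev functions -/

section SobolevAlgebra

variable {F : Type*} [NormedAddCommGroup F] [NormedSpace ℝ F] {Ω : Set ℂ}

lemma IsTestFunction.fderiv_apply {φ : ℂ → ℝ} (hφ : IsTestFunction Ω φ) (h : ℂ) :
    IsTestFunction Ω fun z => fderiv ℝ φ z h := by
  have hs : Function.support (fun z => fderiv ℝ φ z h) ⊆ tsupport φ := fun z hz =>
    support_fderiv_subset ℝ fun h0 => hz (by simp [h0])
  refine ⟨(hφ.1.fderiv_right (m := ∞) le_rfl).clm_apply contDiff_const, ?_, ?_⟩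
  · exact HasCompactSupport.of_support_subset_isCompact hφ.2.1.isCompact hs
  · exact (closure_minimal hs (isClosed_tsupport φ)).trans hφ.2.2

lemma HasWeakDifferential.sub (hΩ : IsOpen Ω) {v v' : ℂ → F} {G G' : ℂ → ℂ →L[ℝ] F}
    (h : HasWeakDifferential Ω v G) (h' : HasWeakDifferential Ω v' G') :
    HasWeakDifferential Ω (fun z => v z - v' z) (fun z => G z - G' z) := by
  refine ⟨h.1.sub h'.1, h.2.1.sub h'.2.1, fun φ hφ w => ?_⟩
  have hd := hφ.fderiv_apply w
  have happ : ∀ {H : ℂ → ℂ →L[ℝ] F}, LocallyIntegrableOn H Ω →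
      IntegrableOn (fun z => φ z • H z w) Ω := fun hH =>
    integrableOn_smul_of_isTestFunction hΩ (locallyIntegrableOn_apply hH w) hφ
  simp only [smul_sub, sub_apply]
  rw [integral_sub (integrableOn_smul_of_isTestFunction hΩ h.1 hd)
    (integrableOn_smul_of_isTestFunction hΩ h'.1 hd), integral_sub (happ h.2.1) (happ h'.2.1),
    h.2.2 φ hφ w, h'.2.2 φ hφ w]
  abel

lemma hasWeakDifferential_const [CompleteSpace F] (c : F) :
    HasWeakDifferential Ω (fun _ => c) fun _ => (0 : ℂ →L[ℝ] F) := by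
  refine ⟨(locallyIntegrable_const c).locallyIntegrableOn _,
    (locallyIntegrable_const _).locallyIntegrableOn _, fun φ hφ w => ?_⟩
  have hd := hφ.fderiv_apply w
  have hset : ∫ z in Ω, fderiv ℝ φ z w • c = ∫ z, fderiv ℝ φ z w • c := by
    refine setIntegral_eq_integral_of_forall_compl_eq_zero fun z hz => ?_
    rw [image_eq_zero_of_notMem_tsupport (f := fun z => fderiv ℝ φ z w) fun h => hz (hd.2.2 h),
      zero_smul]
  have i0 : Integrable fun z => fderiv ℝ φ z w • c :=
    (hd.1.continuous.integrable_of_hasCompactSupport hd.2.1).smul_const c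
  have i1 : Integrable fun z => φ z • c :=
    (hφ.1.continuous.integrable_of_hasCompactSupport hφ.2.1).smul_const c
  have key := integral_smul_fderiv_eq_neg_fderiv_smul_of_integrable (μ := (volume : Measure ℂ))
    (f := φ) (g := fun _ => c) (v := w) i0 (by simp) i1
    (fun z _ => hφ.1.differentiable (by simp) z) (fun z _ => differentiableAt_const c)
  rw [hset]
  simp only [fderiv_fun_const, Pi.zero_apply, zero_apply, smul_zero, integral_zero, neg_zero]
    at key ⊢
  exact neg_eq_zero.1 key.symm

lemma IsSobolev.sub_const [CompleteSpace F] (hΩ : IsOpen Ω) (hb : Bornology.IsBounded Ω) {p : ℝ}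
    {v : ℂ → F} {G : ℂ → ℂ →L[ℝ] F} (h : IsSobolev Ω p v G) (c : F) :
    IsSobolev Ω p (fun z => v z - c) G := by
  have : IsFiniteMeasure (volume.restrict Ω) := ⟨by
    rw [Measure.restrict_apply_univ]; exact hb.measure_lt_top⟩
  refine ⟨?_, h.2.1.sub (memLp_const c), h.2.2⟩
  simpa using h.1.sub hΩ (hasWeakDifferential_const c)

end SobolevAlgebra

/-! ### The weight -/

section Weight

variable {k : ℕ}

lemma weight_base_pos {ε s : ℝ} (hε : 0 < ε) (hs : 0 < s)
    (D : ℂ →L[ℝ] EuclideanSpace ℝ (Fin k)) : 0 < ε ^ 2 + s⁻¹ * hsSq D := by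
  have := hsSq_nonneg D
  positivity

lemma weight_pos {p ε s : ℝ} (hε : 0 < ε) (hs : 0 < s)
    (D : ℂ →L[ℝ] EuclideanSpace ℝ (Fin k)) : 0 < weight p ε s D :=
  Real.rpow_pos_of_pos (weight_base_pos hε hs D) _

/-- The weight grows at most like the power `p - 2` of the differential, uniformly on `Ω`. -/
lemma weight_le {p ε s a g : ℝ} (hp : 2 ≤ p) (hε : 0 < ε) (ha : 0 < a) (hs : a ≤ s)
    {D : ℂ →L[ℝ] EuclideanSpace ℝ (Fin k)} (hD : ‖D‖ ≤ g) (hg : 1 ≤ g) :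
    weight p ε s D ≤ (ε ^ 2 + 2 * a⁻¹) ^ ((p - 2) / 2) * g ^ (p - 2) := by
  have h1 : ε ^ 2 + s⁻¹ * hsSq D ≤ (ε ^ 2 + 2 * a⁻¹) * g ^ 2 := by
    have e1 : s⁻¹ * hsSq D ≤ a⁻¹ * (2 * g ^ 2) :=
      mul_le_mul (inv_anti₀ ha hs) (hsSq_le D hD) (hsSq_nonneg D) (by positivity)
    nlinarith [sq_nonneg ε, one_le_pow₀ hg (n := 2)]
  have h2 : (g ^ 2) ^ ((p - 2) / 2) = g ^ (p - 2) := by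
    rw [← Real.rpow_natCast, ← Real.rpow_mul (by linarith)]
    congr 1
    push_cast
    ring
  rw [← h2, ← Real.mul_rpow (by positivity) (by positivity)]
  exact Real.rpow_le_rpow (weight_base_pos hε (ha.trans_le hs) D).le h1 (by linarith)

/-- For `p ≥ 2` the weight increases with `|D|²`. -/
lemma weight_sub_mul_nonneg {p ε s : ℝ} (hp : 2 ≤ p) (hε : 0 < ε) (hs : 0 < s)
    (D₁ D₂ : ℂ →L[ℝ] EuclideanSpace ℝ (Fin k)) :
    0 ≤ (weight p ε s D₁ - weight p ε s D₂) * (hsSq D₁ - hsSq D₂) := by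
  have hmono : ∀ {X Y : ℂ →L[ℝ] EuclideanSpace ℝ (Fin k)}, hsSq X ≤ hsSq Y →
      weight p ε s X ≤ weight p ε s Y := fun h =>
    Real.rpow_le_rpow (weight_base_pos hε hs _).le
      (add_le_add_right (mul_le_mul_of_nonneg_left h (by positivity)) _) (by linarith)
  rcases le_total (hsSq D₁) (hsSq D₂) with h | h
  · exact mul_nonneg_of_nonpos_of_nonpos (by linarith [hmono h]) (by linarith)
  · exact mul_nonneg (by linarith [hmono h]) (by linarith)

lemma aestronglyMeasurable_weight {α : Type*} [MeasurableSpace α] {μ : Measure α} {p ε : ℝ}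
    {σ : α → ℝ} {G : α → ℂ →L[ℝ] EuclideanSpace ℝ (Fin k)} (hσ : AEStronglyMeasurable σ μ)
    (hG : AEStronglyMeasurable G μ) :
    AEStronglyMeasurable (fun z => weight p ε (σ z) (G z)) μ := by
  have h : AEMeasurable (fun z => ε ^ 2 + (σ z)⁻¹ * hsSq (G z)) μ :=
    aemeasurable_const.add (hσ.aemeasurable.inv.mul (aestronglyMeasurable_hsSq hG).aemeasurable)
  exact (h.pow_const _).aestronglyMeasurable

end Weight

/-! ### Integrability of the flux and the source -/

section Flux

variable {α E : Type*} [MeasurableSpace α] {μ : Measure α} [NormedAddCommGroup E]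
  [InnerProductSpace ℝ E]

lemma memLp_of_norm_le_rpow {F : Type*} [NormedAddCommGroup F] {p r c : ℝ} (hr : 0 < r) {g : α → ℝ}
    (hg : MemLp g (ENNReal.ofReal p) μ) (hg0 : ∀ z, 0 ≤ g z) {f : α → F}
    (hf : AEStronglyMeasurable f μ) (hle : ∀ᵐ z ∂μ, ‖f z‖ ≤ c * g z ^ r) :
    MemLp f (ENNReal.ofReal (p / r)) μ := by
  have h := hg.norm_rpow_div (ENNReal.ofReal r)
  rw [← ENNReal.ofReal_div_of_pos hr, ENNReal.toReal_ofReal hr.le] at h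
  refine h.of_le_mul (c := c) hf ?_
  filter_upwards [hle] with z hz
  have hn : 0 ≤ ‖g z‖ ^ r := by positivity
  rwa [Real.norm_of_nonneg hn, Real.norm_of_nonneg (hg0 z)]

lemma norm_pairL_le (D : ℂ →L[ℝ] E) : ‖pairL E D‖ ≤ 2 * ‖D‖ := by
  refine ContinuousLinearMap.opNorm_le_bound _ (by positivity) fun D' => ?_
  rw [pairL_apply, Real.norm_eq_abs]
  refine (abs_add_le _ _).trans ?_
  have e1 : |inner ℝ (D 1) (D' 1)| ≤ ‖D‖ * ‖D'‖ := (abs_real_inner_le_norm _ _).trans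
    (mul_le_mul (norm_apply_one_le D) (norm_apply_one_le D') (norm_nonneg _) (norm_nonneg _))
  have eI : |inner ℝ (D Complex.I) (D' Complex.I)| ≤ ‖D‖ * ‖D'‖ :=
    (abs_real_inner_le_norm _ _).trans
      (mul_le_mul (norm_apply_I_le D) (norm_apply_I_le D') (norm_nonneg _) (norm_nonneg _))
  linarith

lemma norm_innerL_le (b : E) : ‖innerL E b‖ ≤ ‖b‖ :=
  ContinuousLinearMap.opNorm_le_bound _ (norm_nonneg _) fun v => abs_real_inner_le_norm b v

lemma memLp_neg_smul_of_le_rpow {F : Type*} [NormedAddCommGroup F] [NormedSpace ℝ F] {p r c : ℝ}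
    (hr : 0 < r) {g : α → ℝ} (hg : MemLp g (ENNReal.ofReal p) μ) (hg0 : ∀ z, 0 ≤ g z)
    {l : α → ℝ} {A : α → F} (hl : AEStronglyMeasurable l μ) (hA : AEStronglyMeasurable A μ)
    (hle : ∀ᵐ z ∂μ, |l z| * ‖A z‖ ≤ c * g z ^ r) :
    MemLp (fun z => -(l z • A z)) (ENNReal.ofReal (p / r)) μ := by
  refine memLp_of_norm_le_rpow (c := c) hr hg hg0 (hl.smul hA).neg ?_
  filter_upwards [hle] with z hz
  simpa [norm_smul] using hz

lemma memLp_smul_pairL {p c : ℝ} (hp : 1 < p) {l : α → ℝ} {G : α → ℂ →L[ℝ] E}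
    (hl : AEStronglyMeasurable l μ) (hG : AEStronglyMeasurable G μ)
    (hg : MemLp (fun z => 1 + ‖G z‖) (ENNReal.ofReal p) μ)
    (hle : ∀ᵐ z ∂μ, |l z| ≤ c * (1 + ‖G z‖) ^ (p - 2)) :
    MemLp (fun z => -(l z • pairL E (G z))) (ENNReal.ofReal (p / (p - 1))) μ := by
  have hA : AEStronglyMeasurable (fun z => pairL E (G z)) μ :=
    (pairL E).continuous.comp_aestronglyMeasurable hG
  refine memLp_neg_smul_of_le_rpow (F := (ℂ →L[ℝ] E) →L[ℝ] ℝ) (c := 2 * c) (by linarith) hg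
    (fun z => by positivity) hl hA ?_
  filter_upwards [hle] with z hz
  have hg : 0 < 1 + ‖G z‖ := by positivity
  have e : (1 + ‖G z‖) ^ (p - 1) = (1 + ‖G z‖) ^ (p - 2) * (1 + ‖G z‖) := by
    rw [← Real.rpow_add_one hg.ne']
    congr 1
    ring
  rw [e]
  calc |l z| * ‖pairL E (G z)‖ ≤ (c * (1 + ‖G z‖) ^ (p - 2)) * (2 * (1 + ‖G z‖)) :=
        mul_le_mul hz ((norm_pairL_le _).trans (by linarith))
          (ContinuousLinearMap.opNorm_nonneg _)
          ((abs_nonneg _).trans hz)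
    _ = _ := by ring

end Flux

/-! ### The weak equation of a perturbed solution -/

section Solution

variable {N' : Type*} [MetricSpace N'] [ChartedSpace (EuclideanSpace ℝ (Fin 2)) N']
  [RiemannianBundle (fun x : N' => TangentSpace (𝓡 2) x)] {k : ℕ}
  {i : N' → EuclideanSpace ℝ (Fin k)}

/-- `A'(v)(∂_x v, ∂_x v) + A'(v)(∂_y v, ∂_y v)` at a point where `u = x` and `dv = D`. -/
def curvatureSum (i : N' → EuclideanSpace ℝ (Fin k)) (x : N')
    (D : ℂ →L[ℝ] EuclideanSpace ℝ (Fin k)) : EuclideanSpace ℝ (Fin k) :=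
  secondForm i x (D 1) + secondForm i x (D Complex.I)

lemma curvatureTerm_eq (s : ℝ) (x : N') (D : ℂ →L[ℝ] EuclideanSpace ℝ (Fin k)) :
    curvatureTerm i s x D = s⁻¹ • curvatureSum i x D := rfl

/-- The curvature term is measurable because the second fundamental form is continuous and the
embedding `i` allows one to recover `u` from `i ∘ u`. -/
lemma aestronglyMeasurable_curvatureSum [IsManifold (𝓡 2) ∞ N']
    (hi : IsIsometricEmbedding i) {μ : Measure ℂ} {u : ℂ → N'}
    {G : ℂ → ℂ →L[ℝ] EuclideanSpace ℝ (Fin k)}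
    (hu : AEStronglyMeasurable (fun z => i (u z)) μ) (hG : AEStronglyMeasurable G μ) :
    AEStronglyMeasurable (fun z => curvatureSum i (u z) (G z)) μ := by
  have hu' : AEStronglyMeasurable u μ := hi.isEmbedding.aestronglyMeasurable_comp_iff.1 hu
  have h : ∀ w : ℂ, AEStronglyMeasurable (fun z => secondForm i (u z) (G z w)) μ := fun w =>
    (continuous_secondForm hi).comp_aestronglyMeasurable (f := fun z => (u z, G z w))
      (hu'.prodMk (hG.apply_continuousLinearMap w))
  exact (h 1).add (h Complex.I)

lemma exists_curvatureSum_bounds [CompactSpace N'] [IsManifold (𝓡 2) ∞ N']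
    (hi : IsIsometricEmbedding i) :
    ∃ C : ℝ, 0 < C ∧
      (∀ (x : N') (D : ℂ →L[ℝ] EuclideanSpace ℝ (Fin k)), ‖curvatureSum i x D‖ ≤ C * hsSq D) ∧
      ∀ (x y : N') (D : ℂ →L[ℝ] EuclideanSpace ℝ (Fin k)),
        |inner ℝ (curvatureSum i x D) (i y - i x)| ≤ C * (hsSq D * ‖i y - i x‖ ^ 2) := by
  obtain ⟨C, hC, h1, h2⟩ := exists_secondForm_bounds hi
  refine ⟨C, hC, fun x D => ?_, fun x y D => ?_⟩
  · refine (norm_add_le _ _).trans ?_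
    rw [hsSq, mul_add]
    exact add_le_add (h1 x _) (h1 x _)
  · rw [curvatureSum, inner_add_left]
    refine (abs_add_le _ _).trans ((add_le_add (h2 x y _) (h2 x y _)).trans (le_of_eq ?_))
    rw [hsSq]
    ring

variable {Ω : Set ℂ} {σ : ℂ → ℝ} {p ε a : ℝ} {u : ℂ → N'}
  {G : ℂ → ℂ →L[ℝ] EuclideanSpace ℝ (Fin k)}

lemma memLp_one_add_norm (hb : Bornology.IsBounded Ω) {q : ℝ≥0∞}
    {F : Type*} [NormedAddCommGroup F] {f : ℂ → F} (hf : MemLp f q (volume.restrict Ω)) :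
    MemLp (fun z => 1 + ‖f z‖) q (volume.restrict Ω) := by
  have : IsFiniteMeasure (volume.restrict Ω) := ⟨by
    rw [Measure.restrict_apply_univ]; exact hb.measure_lt_top⟩
  exact (memLp_const (1 : ℝ)).add hf.norm

/-- The flux `λ^ε ∇v` is in the dual space of `L^p`. -/
lemma memLp_flux (hΩ : IsOpen Ω) (hb : Bornology.IsBounded Ω) (hσ : ContinuousOn σ Ω) (ha : 0 < a)
    (hσa : ∀ z ∈ Ω, a ≤ σ z) (hp : 2 ≤ p) (hε : 0 < ε)
    (hG : MemLp G (ENNReal.ofReal p) (volume.restrict Ω)) :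
    MemLp (fun z => -(weight p ε (σ z) (G z) • pairL (EuclideanSpace ℝ (Fin k)) (G z)))
      (ENNReal.ofReal (p / (p - 1))) (volume.restrict Ω) := by
  refine memLp_smul_pairL (by linarith) (c := (ε ^ 2 + 2 * a⁻¹) ^ ((p - 2) / 2))
    (aestronglyMeasurable_weight (hσ.aestronglyMeasurable hΩ.measurableSet) hG.1) hG.1
    (memLp_one_add_norm hb hG) ?_
  filter_upwards [ae_restrict_mem hΩ.measurableSet] with z hz
  rw [abs_of_pos (weight_pos hε (ha.trans_le (hσa z hz)) (G z))]
  exact weight_le hp hε ha (hσa z hz) (by linarith) (by linarith [norm_nonneg (G z)])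

lemma weight_mul_sq_le (ha : 0 < a) (hσa : ∀ z ∈ Ω, a ≤ σ z) (hp : 2 ≤ p) (hε : 0 < ε) {z : ℂ}
    (hz : z ∈ Ω) {g : ℝ} (hg : 1 ≤ g) (hGg : ‖G z‖ ≤ g) :
    weight p ε (σ z) (G z) * g ^ 2 ≤ (ε ^ 2 + 2 * a⁻¹) ^ ((p - 2) / 2) * g ^ p := by
  have hle := weight_le hp hε ha (hσa z hz) hGg hg
  have hg0 : 0 < g := by linarith
  have e : g ^ p = g ^ (p - 2) * g ^ 2 := by
    rw [← Real.rpow_natCast, ← Real.rpow_add hg0]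
    congr 1
    push_cast
    ring
  rw [e, ← mul_assoc]
  gcongr

lemma integrable_weight_mul_sq (hΩ : IsOpen Ω) (hσ : ContinuousOn σ Ω) (ha : 0 < a)
    (hσa : ∀ z ∈ Ω, a ≤ σ z) (hp : 2 ≤ p) (hε : 0 < ε)
    (hG : AEStronglyMeasurable G (volume.restrict Ω)) {g : ℂ → ℝ}
    (hg : MemLp g (ENNReal.ofReal p) (volume.restrict Ω)) (hg1 : ∀ z, 1 ≤ g z)
    (hGg : ∀ z, ‖G z‖ ≤ g z) :
    Integrable (fun z => weight p ε (σ z) (G z) * g z ^ 2) (volume.restrict Ω) := by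
  have h := memLp_of_norm_le_rpow (c := (ε ^ 2 + 2 * a⁻¹) ^ ((p - 2) / 2))
    (f := fun z => weight p ε (σ z) (G z) * g z ^ 2) (r := p) (by linarith) hg
    (fun z => zero_le_one.trans (hg1 z))
    ((aestronglyMeasurable_weight (hσ.aestronglyMeasurable hΩ.measurableSet) hG).mul
      (hg.1.pow 2)) ?_
  · rw [div_self (by linarith), ENNReal.ofReal_one] at h
    exact memLp_one_iff_integrable.1 h
  · filter_upwards [ae_restrict_mem hΩ.measurableSet] with z hz
    have hpos := weight_pos (p := p) hε (ha.trans_le (hσa z hz)) (G z)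
    rw [Real.norm_of_nonneg (by positivity)]
    exact weight_mul_sq_le ha hσa hp hε hz (hg1 z) (hGg z)

/-- The right hand side `λ^ε A'(v)(∇v, ∇v)` is integrable. -/
lemma memLp_source [CompactSpace N'] [IsManifold (𝓡 2) ∞ N'] (hi : IsIsometricEmbedding i)
    (hΩ : IsOpen Ω) (hb : Bornology.IsBounded Ω)
    (hσ : ContinuousOn σ Ω) (ha : 0 < a) (hσa : ∀ z ∈ Ω, a ≤ σ z) (hp : 2 ≤ p) (hε : 0 < ε)
    (hu : AEStronglyMeasurable (fun z => i (u z)) (volume.restrict Ω))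
    (hG : MemLp G (ENNReal.ofReal p) (volume.restrict Ω)) :
    MemLp (fun z => weight p ε (σ z) (G z) • innerL _ (curvatureSum i (u z) (G z))) 1
      (volume.restrict Ω) := by
  obtain ⟨C, hC, hbd, -⟩ := exists_curvatureSum_bounds hi
  have hg := memLp_one_add_norm hb hG
  have hint := integrable_weight_mul_sq (p := p) (ε := ε) hΩ hσ ha hσa hp hε hG.1 hg
    (fun z => by linarith [norm_nonneg (G z)]) (fun z => by linarith)
  refine (memLp_one_iff_integrable.2 hint).of_le_mul (c := 2 * C) ?_ ?_
  · exact (aestronglyMeasurable_weight (hσ.aestronglyMeasurable hΩ.measurableSet) hG.1).smul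
      ((innerL _).continuous.comp_aestronglyMeasurable
        (aestronglyMeasurable_curvatureSum hi hu hG.1))
  · filter_upwards [ae_restrict_mem hΩ.measurableSet] with z hz
    have hpos := weight_pos (p := p) hε (ha.trans_le (hσa z hz)) (G z)
    have h1 : ‖innerL _ (curvatureSum i (u z) (G z))‖ ≤ C * (2 * (1 + ‖G z‖) ^ 2) := by
      refine (norm_innerL_le _).trans ((hbd _ _).trans ?_)
      gcongr
      exact hsSq_le _ (by linarith)
    rw [norm_smul, Real.norm_of_nonneg hpos.le, Real.norm_of_nonneg (by positivity)]
    calc _ ≤ weight p ε (σ z) (G z) * (C * (2 * (1 + ‖G z‖) ^ 2)) := by gcongr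
      _ = _ := by ring

/-- The conformal factor drops out of the weak equation, up to its role in the weight. -/
lemma weakEq_of_solution (hΩ : IsOpen Ω) (hσ : ∀ z ∈ Ω, 0 < σ z)
    {ψ : ℂ → EuclideanSpace ℝ (Fin k)}
    (h : - ∫ z in Ω, weight p ε (σ z) (G z) * gradInner (σ z) (G z) (fderiv ℝ ψ z) * σ z =
      ∫ z in Ω, weight p ε (σ z) (G z) *
        inner ℝ (curvatureTerm i (σ z) (u z) (G z)) (ψ z) * σ z) :
    WeakEq Ω (fun z => -(weight p ε (σ z) (G z) • pairL _ (G z)))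
      (fun z => weight p ε (σ z) (G z) • innerL _ (curvatureSum i (u z) (G z))) ψ
      (fderiv ℝ ψ) := by
  rw [← integral_neg] at h
  refine Eq.trans (setIntegral_congr_fun hΩ.measurableSet fun z hz => ?_)
    (h.trans (setIntegral_congr_fun hΩ.measurableSet fun z hz => ?_))
  · have hs := (hσ z hz).ne'
    change -(weight p ε (σ z) (G z) * pairL _ (G z) (fderiv ℝ ψ z)) = _
    simp only [pairL_apply, gradInner]
    field_simp
  · have hs := (hσ z hz).ne'
    change _ = weight p ε (σ z) (G z) * inner ℝ (curvatureSum i (u z) (G z)) (ψ z)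
    simp only [curvatureTerm_eq, real_inner_smul_left]
    field_simp

end Solution

end PHarm

end

theorem theoremA2
    {N' : Type*} [MetricSpace N'] [CompactSpace N']
    [ChartedSpace (EuclideanSpace ℝ (Fin 2)) N'] [IsManifold (𝓡 2) ∞ N']
    [RiemannianBundle (fun x : N' => TangentSpace (𝓡 2) x)]
    [IsContMDiffRiemannianBundle (𝓡 2) ∞ (EuclideanSpace ℝ (Fin 2))
      (fun x : N' => TangentSpace (𝓡 2) x)]
    [IsRiemannianManifold (𝓡 2) N']
    {k : ℕ} (i : N' → EuclideanSpace ℝ (Fin k)) (hi : PHarm.IsIsometricEmbedding i)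
    (p : ℝ) (hp : 2 ≤ p) :
    ∃ r₀ : ℝ, 0 < r₀ ∧
      ∀ (Ω : Set ℂ) (σ : ℂ → ℝ), IsOpen Ω → Bornology.IsBounded Ω → ContinuousOn σ Ω →
        (∃ a b : ℝ, 0 < a ∧ ∀ z ∈ Ω, a ≤ σ z ∧ σ z ≤ b) →
      ∀ (ε : ℝ), 0 < ε →
      ∀ (x : N') (u₁ u₂ : ℂ → N'),
        PHarm.IsPerturbedSolution i Ω σ p ε u₁ →
        PHarm.IsPerturbedSolution i Ω σ p ε u₂ →
        (∀ᵐ z ∂(volume.restrict Ω), u₁ z ∈ Metric.ball x r₀) →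
        (∀ᵐ z ∂(volume.restrict Ω), u₂ z ∈ Metric.ball x r₀) →
        PHarm.IsSobolevZero Ω p (fun z => i (u₁ z) - i (u₂ z)) →
        ∀ᵐ z ∂(volume.restrict Ω), i (u₁ z) = i (u₂ z) := by
  obtain ⟨C, hC, hbd, hbd₂⟩ := PHarm.exists_curvatureSum_bounds hi
  have hicont : Continuous i := hi.isEmbedding.continuous
  -- `δ` is chosen so that `C δ ≤ 1 / 4` and `C δ² ≤ 1 / 32`
  obtain ⟨δ, hδ, hδ1, hδ2⟩ : ∃ δ : ℝ, 0 < δ ∧ C * δ ≤ 1 / 4 ∧ C * δ ^ 2 ≤ 1 / 32 := by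
    refine ⟨1 / (8 * (C + 1)), by positivity, ?_, ?_⟩
    · rw [mul_one_div, div_le_iff₀ (by positivity)]
      linarith
    · rw [one_div, inv_pow, ← div_eq_mul_inv, div_le_iff₀ (by positivity)]
      nlinarith
  -- by uniform continuity, `i` maps every ball of radius `r₀` into a ball of radius `δ`
  obtain ⟨r₀, hr₀, hunif⟩ := Metric.uniformContinuous_iff.1
    (CompactSpace.uniformContinuous_of_continuous hicont) δ hδ
  refine ⟨r₀, hr₀, ?_⟩
  intro Ω σ hΩ hb hσ hσab ε hε x u₁ u₂ hs₁ hs₂ hball₁ hball₂ hη0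
  obtain ⟨a, b, ha, hab⟩ := hσab
  have hσa : ∀ z ∈ Ω, a ≤ σ z := fun z hz => (hab z hz).1
  have hσ0 : ∀ z ∈ Ω, 0 < σ z := fun z hz => ha.trans_le (hσa z hz)
  obtain ⟨G₁, hG₁, heq₁⟩ := hs₁
  obtain ⟨G₂, hG₂, heq₂⟩ := hs₂
  obtain ⟨M, hM⟩ : ∃ M, ∀ y, ‖i y - i x‖ ≤ M := by
    obtain ⟨M, hM⟩ := isCompact_univ.exists_bound_of_continuousOn
      (hicont.sub (continuous_const (y := i x))).continuousOn
    exact ⟨M, fun y => hM y (Set.mem_univ y)⟩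
  have hw₁ : ∀ᵐ z ∂(volume.restrict Ω), ‖i (u₁ z) - i x‖ ≤ δ := hball₁.mono fun z hz => by
    rw [← dist_eq_norm]
    exact (hunif hz).le
  have hw₂ : ∀ᵐ z ∂(volume.restrict Ω), ‖i (u₂ z) - i x‖ ≤ δ := hball₂.mono fun z hz => by
    rw [← dist_eq_norm]
    exact (hunif hz).le
  have hηR : ∀ z, ‖i (u₁ z) - i (u₂ z)‖ ≤ M + M := fun z => by
    rw [← sub_sub_sub_cancel_right _ _ (i x)]
    exact (norm_sub_le _ _).trans (add_le_add (hM _) (hM _))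
  have hM0 : 0 ≤ M := (norm_nonneg _).trans (hM x)
  obtain ⟨D, θ, K, hη, hθ, hθK, hlim, hlim'⟩ := hη0.exists_bounded_approx (by linarith)
    (by positivity) (ae_of_all _ hηR)
  set η : ℂ → EuclideanSpace ℝ (Fin k) := fun z => i (u₁ z) - i (u₂ z) with hηdef
  have hD : ∀ᵐ z ∂(volume.restrict Ω), D z = G₁ z - G₂ z :=
    PHarm.weakDifferential_unique hΩ hη.1 (hG₁.1.sub hΩ hG₂.1)
  -- a common majorant in `L^p` of `1` and of all differentials that occur
  set g : ℂ → ℝ := fun z => 1 + ‖G₁ z‖ + ‖G₂ z‖ with hgdef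
  have hgL : MemLp g (ENNReal.ofReal p) (volume.restrict Ω) :=
    (PHarm.memLp_one_add_norm hb hG₁.2.2).add hG₂.2.2.norm
  have hg1 : ∀ z, 1 ≤ g z := fun z => by
    simp only [hgdef]
    linarith [norm_nonneg (G₁ z), norm_nonneg (G₂ z)]
  have hgG₁ : ∀ z, ‖G₁ z‖ ≤ g z := fun z => by
    simp only [hgdef]
    linarith [norm_nonneg (G₂ z)]
  have hgG₂ : ∀ z, ‖G₂ z‖ ≤ g z := fun z => by
    simp only [hgdef]
    linarith [norm_nonneg (G₁ z)]
  have hgD : ∀ᵐ z ∂(volume.restrict Ω), ‖D z‖ ≤ g z := by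
    filter_upwards [hD] with z hz
    rw [hz]
    refine (norm_sub_le _ _).trans ?_
    simp only [hgdef]
    linarith
  have hσm : AEStronglyMeasurable σ (volume.restrict Ω) :=
    hσ.aestronglyMeasurable hΩ.measurableSet
  have hpos : ∀ G : ℂ → ℂ →L[ℝ] EuclideanSpace ℝ (Fin k),
      ∀ᵐ z ∂(volume.restrict Ω), 0 < PHarm.weight p ε (σ z) (G z) := fun G => by
    filter_upwards [ae_restrict_mem hΩ.measurableSet] with z hz
    exact PHarm.weight_pos hε (hσ0 z hz) _
  have hpq : (p / (p - 1)).HolderConjugate p :=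
    (Real.HolderConjugate.conjExponent (by linarith)).symm
  have hHolder : (ENNReal.ofReal (p / (p - 1))).HolderTriple (ENNReal.ofReal p) 1 :=
    hpq.ennrealOfReal
  have hηK : ∀ᵐ z ∂(volume.restrict Ω), ‖η z‖ ≤ max K (M + M) :=
    ae_of_all _ fun z => (hηR z).trans (le_max_right _ _)
  have hθK' : ∀ n z, ‖θ n z‖ ≤ max K (M + M) := fun n z => (hθK n z).trans (le_max_left _ _)
  -- for each solution: the equation tested with `η`, and the Caccioppoli inequality
  have hsol : ∀ {u : ℂ → N'} {G : ℂ → ℂ →L[ℝ] EuclideanSpace ℝ (Fin k)},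
      PHarm.IsSobolev Ω p (fun z => i (u z)) G → (∀ z, ‖G z‖ ≤ g z) →
      (∀ᵐ z ∂(volume.restrict Ω), ‖i (u z) - i x‖ ≤ δ) →
      (∀ ψ : ℂ → EuclideanSpace ℝ (Fin k), PHarm.IsTestFunction Ω ψ →
        - ∫ z in Ω, PHarm.weight p ε (σ z) (G z) *
            PHarm.gradInner (σ z) (G z) (fderiv ℝ ψ z) * σ z =
          ∫ z in Ω, PHarm.weight p ε (σ z) (G z) *
            inner ℝ (PHarm.curvatureTerm i (σ z) (u z) (G z)) (ψ z) * σ z) →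
      Integrable (fun z => PHarm.weight p ε (σ z) (G z) * g z ^ 2) (volume.restrict Ω) ∧
      (∫ z in Ω, -(PHarm.weight p ε (σ z) (G z) * PHarm.pairL _ (G z) (D z)) =
        ∫ z in Ω, PHarm.weight p ε (σ z) (G z) *
          inner ℝ (PHarm.curvatureSum i (u z) (G z)) (η z)) ∧
      ∫ z in Ω, PHarm.weight p ε (σ z) (G z) * (PHarm.hsSq (G z) * ‖η z‖ ^ 2) ≤
        8 * δ ^ 2 * ∫ z in Ω, PHarm.weight p ε (σ z) (G z) * PHarm.hsSq (D z) := by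
    intro u G hG hGg hwδ heq
    have hint := PHarm.integrable_weight_mul_sq (p := p) (ε := ε) hΩ hσ ha hσa hp hε hG.2.2.1
      hgL hg1 hGg
    obtain ⟨t1, t2⟩ := PHarm.weakEq_of_isSobolevZero hΩ (by linarith)
      (PHarm.memLp_flux hΩ hb hσ ha hσa hp hε hG.2.2)
      (PHarm.memLp_source hi hΩ hb hσ ha hσa hp hε hG.2.1.1 hG.2.2)
      (fun ψ hψ => PHarm.weakEq_of_solution hΩ hσ0 (heq ψ hψ)) hη hθ hθK' hηK hlim hlim'
    have hG' := hG.sub_const hΩ hb (i x)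
    have t3 := t2 _ G M hG' fun z => hM (u z)
    exact ⟨hint, t1, PHarm.caccioppoli hG.2.2.1 hη.2.2.1 hη.2.1.1 hG'.2.1.1
      (PHarm.aestronglyMeasurable_curvatureSum hi hG.2.1.1 hG.2.2.1)
      (PHarm.aestronglyMeasurable_weight hσm hG.2.2.1) hint (hpos G) (ae_of_all _ hGg) hgD hηK
      hC.le hδ1 hwδ (ae_of_all _ fun z => hbd _ _) t3⟩
  obtain ⟨hint₁, e₁, c₁⟩ := hsol hG₁ hgG₁ hw₁ heq₁
  obtain ⟨hint₂, e₂, c₂⟩ := hsol hG₂ hgG₂ hw₂ heq₂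
  have hD0 : ∀ᵐ z ∂(volume.restrict Ω), D z = 0 := by
    refine PHarm.ae_eq_zero_of_energy hG₁.2.2.1 hG₂.2.2.1 hη.2.2.1 hη.2.1.1
      (PHarm.aestronglyMeasurable_curvatureSum hi hG₁.2.1.1 hG₁.2.2.1)
      (PHarm.aestronglyMeasurable_curvatureSum hi hG₂.2.1.1 hG₂.2.2.1)
      (PHarm.aestronglyMeasurable_weight hσm hG₁.2.2.1)
      (PHarm.aestronglyMeasurable_weight hσm hG₂.2.2.1) hint₁ hint₂ (hpos G₁) (hpos G₂)
      (ae_of_all _ hgG₁) (ae_of_all _ hgG₂) hgD hηK hC.le hδ2 hD ?_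
      (ae_of_all _ fun z => ?_) (ae_of_all _ fun z => ?_) e₁ e₂ c₁ c₂
    · filter_upwards [ae_restrict_mem hΩ.measurableSet] with z hz
      exact PHarm.weight_sub_mul_nonneg hp hε (hσ0 z hz) _ _
    · have h := hbd₂ (u₁ z) (u₂ z) (G₁ z)
      rwa [← neg_sub (i (u₁ z)), inner_neg_right, abs_neg, norm_neg] at h
    · exact hbd₂ (u₂ z) (u₁ z) (G₂ z)
  filter_upwards [PHarm.IsSobolevZero.ae_eq_zero hb (by linarith) hη hθ hlim hlim' hD0] with z hz
  exact sub_eq_zero.1 hz
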